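/- Let $A,C\in\mathbb R^{n\times n}$ with $C=C'$, let $\sigma\in\mathbb R^{n\times m}$, $\Sigma=\sigma\sigma'$, and let $\tau\in\mathbb R$. Let $(P_t,S_t,Q_t)$, $t\in[\tau,0]$, be $n\times n$ real matrices with $P_0,Q_0$ symmetric, $S_0$ invertible, and $$-\dot P_t=A'P_t+P_tA+C+P_t\Sigma P_t,\qquad -\dot S_t=(A+\Sigma P_t)'S_t,\qquad -\dot Q_t=S_t'\Sigma S_t .$$ Put $\phi_t(x,z)=\tfrac12x'P_tx+x'S_tz+\tfrac12z'Q_tz$. Assume that $\dot x_t=Ax_t+\sigma u_t$ is controllable: for all $\tau\le s<t\le0$ and all $a,b\in\mathbb R^n$ some $u\in L_2(s,t)$ steers $x_s=a$ to $x_t=b$. For $s<t$ let $$\mathcal S_s^t[\psi](a)=\sup_{u\in L_2(s,t)}\Big\{\int_s^t\big(\tfrac12x_r'Cx_r-\tfrac12|u_r|^2\big)\,dr+\psi(x_t)\ :\ \dot x_r=Ax_r+\sigma u_r,\ x_s=a\Big\}.$$ (1) Let $t_1,t_2<0$, $\tau\le t_1+t_2$, and suppose that $x\mapsto\phi_{t_2}(x,z)-\phi_0(x,z)$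 is strictly convex (for every $z$). Then for all $x,z$ $$\mathcal S_{t_1}^0[\phi_{t_2}(\cdot,z)](x)=\mathcal S_{t_2}^0[\phi_{t_1}(\cdot,z)](x)=\mathcal S_{t_1+t_2}^{t_2}[\phi_{t_2}(\cdot,z)](x)=\phi_{t_1+t_2}(x,z),$$ for all $z,\bar z$ $$\inf_x\big[\phi_{t_2}(x,\bar z)-\phi_0(x,z)\big]=\inf_y\big[\phi_{t_1+t_2}(y,\bar z)-\phi_{t_1}(y,z)\big]\in\mathbb R,$$ and $$\begin{aligned} P_{t_1+t_2}&=P_{t_1}+S_{t_1}\{(Q_0-Q_{t_1})+S_0'(P_{t_2}-P_0)^{-1}S_0\}^{-1}S_{t_1}',\\ S_{t_1+t_2}&=S_{t_1}\{(Q_0-Q_{t_1})+S_0'(P_{t_2}-P_0)^{-1}S_0\}^{-1}S_0'(P_{t_2}-P_0)^{-1}S_{t_2},\\ Q_{t_1+t_2}&=Q_{t_2}+S_{t_2}'\{(P_0-P_{t_2})+S_0(Q_{t_1}-Q_0)^{-1}S_0'\}^{-1}S_{t_2}, \end{aligned}$$ where all the inverses exist. (2) Let $\Delta\ge0$ be such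 that $x\mapsto\phi_{-\Delta}(x,z)-\phi_0(x,z)$ is strictly convex (for every $z$). If $\tau\le-2\Delta$, then $$\begin{aligned} P_{-2\Delta}&=P_{-\Delta}+S_{-\Delta}\{(Q_0-Q_{-\Delta})+S_0'(P_{-\Delta}-P_0)^{-1}S_0\}^{-1}S_{-\Delta}',\\ S_{-2\Delta}&=S_{-\Delta}\{(Q_0-Q_{-\Delta})+S_0'(P_{-\Delta}-P_0)^{-1}S_0\}^{-1}S_0'(P_{-\Delta}-P_0)^{-1}S_{-\Delta},\\ Q_{-2\Delta}&=Q_{-\Delta}+S_{-\Delta}'\{(P_0-P_{-\Delta})+S_0(Q_{-\Delta}-Q_0)^{-1}S_0'\}^{-1}S_{-\Delta}, \end{aligned}$$ where all the inverses exist. Moreover, for every $N\in\mathbb N$ with $\tau\le-2^N\Delta$, the function $x\mapsto\phi_{-2^N\Delta}(x,z)-\phi_0(x,z)$ is again strictly convex (for every $z$), and $N$ applications of this doubling map (with $P_0,S_0,Q_0$ fixed) to $(P_{-\Delta},S_{-\Delta},Q_{-\Delta})$ give $(P_{-2^N\Delta},S_{-2^N\Delta},Q_{-2^N\Delta})$.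 (3) Let $\tau\le t\le0$ and let $p$ solve $-\dot p=A'p+pA+C+p\Sigma p$ on $[t,0]$ with $p_0$ symmetric and $p_0-P_0$ invertible. Then $$p_t=P_t-S_t\big(Q_t-Q_0-S_0'(p_0-P_0)^{-1}S_0\big)^{-1}S_t',$$ where the inverse exists. -/

import Mathlib

open Matrix MeasureTheory Set

namespace RiccatiDoubling

/-- The bivariate quadratic `½ x'Px + x'Sz + ½ z'Qz` with parameters `(P, S, Q)`. -/
noncomputable def biquad {n : ℕ} (P S Q : Matrix (Fin n) (Fin n) ℝ) (x z : Fin n → ℝ) : ℝ :=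
  1 / 2 * (x ⬝ᵥ (P *ᵥ x)) + x ⬝ᵥ (S *ᵥ z) + 1 / 2 * (z ⬝ᵥ (Q *ᵥ z))

/-- `-ṗ = A'p + pA + C + p σσ' p` on the time interval `[τ, 0]`. The derivatives are taken entry by
entry; they are one-sided at the two end points. -/
def SolvesRiccati {n m : ℕ} (A C : Matrix (Fin n) (Fin n) ℝ) (σ : Matrix (Fin n) (Fin m) ℝ)
    (τ : ℝ) (p : ℝ → Matrix (Fin n) (Fin n) ℝ) : Prop :=
  ∀ t ∈ Icc τ 0, ∀ i j, HasDerivWithinAt (fun s => p s i j)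
    ((-(Aᵀ * p t + p t * A + C + p t * (σ * σᵀ) * p t)) i j) (Icc τ 0) t

/-- The triple `(P, S, Q)` satisfies, on `[τ, 0]`,
`-Ṗ = A'P + PA + C + P σσ' P`, `-Ṡ = (A + σσ'P)'S`, `-Q̇ = S' σσ' S`. -/
structure SolvesBiRiccati {n m : ℕ} (A C : Matrix (Fin n) (Fin n) ℝ) (σ : Matrix (Fin n) (Fin m) ℝ)
    (τ : ℝ) (P S Q : ℝ → Matrix (Fin n) (Fin n) ℝ) : Prop where
  eqP : SolvesRiccati A C σ τ P
  eqS : ∀ t ∈ Icc τ 0, ∀ i j, HasDerivWithinAt (fun s => S s i j)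
    ((-((A + (σ * σᵀ) * P t)ᵀ * S t)) i j) (Icc τ 0) t
  eqQ : ∀ t ∈ Icc τ 0, ∀ i j, HasDerivWithinAt (fun s => Q s i j)
    ((-((S t)ᵀ * (σ * σᵀ) * S t)) i j) (Icc τ 0) t

/-- `x` is the state trajectory on `[s, t]` of `ẋ = Ax + σu` under the control `u ∈ L²(s, t)`:
a continuous solution of the integrated equation. (The choice of norm on `Fin m → ℝ` does not
affect membership in `L²`.) -/
structure IsTrajectory {n m : ℕ} (A : Matrix (Fin n) (Fin n) ℝ) (σ : Matrix (Fin n) (Fin m) ℝ)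
    (s t : ℝ) (u : ℝ → Fin m → ℝ) (x : ℝ → Fin n → ℝ) : Prop where
  control : MemLp u 2 (volume.restrict (Icc s t))
  continuous : ContinuousOn x (Icc s t)
  dynamics : ∀ r ∈ Icc s t, x r = x s + ∫ w in s..r, (A *ᵥ x w + σ *ᵥ u w)

/-- Every state can be steered to every state during `[s, t]`. -/
def ControllableOn {n m : ℕ} (A : Matrix (Fin n) (Fin n) ℝ) (σ : Matrix (Fin n) (Fin m) ℝ)
    (s t : ℝ) : Prop :=
  ∀ a b : Fin n → ℝ, ∃ u x, IsTrajectory A σ s t u x ∧ x s = a ∧ x t = b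

/-- The value operator `𝒮_s^t[ψ](a)`: the supremum over `u ∈ L²(s, t)` of
`∫_s^t (½ x'Cx - ½ |u|²) dr + ψ(x_t)`, where `ẋ = Ax + σu` and `x_s = a`. -/
noncomputable def valueOp {n m : ℕ} (A C : Matrix (Fin n) (Fin n) ℝ) (σ : Matrix (Fin n) (Fin m) ℝ)
    (s t : ℝ) (ψ : (Fin n → ℝ) → ℝ) (a : Fin n → ℝ) : EReal :=
  sSup {v : EReal | ∃ u x, IsTrajectory A σ s t u x ∧ x s = a ∧
    v = (((∫ r in s..t, (1 / 2 * (x r ⬝ᵥ (C *ᵥ x r)) - 1 / 2 * (u r ⬝ᵥ u r))) + ψ (x t) : ℝ) :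
      EReal)}

/-- The semiconvex dual `inf_x [p(x) - φ(x, z)]` of `p` under the kernel `φ`. -/
noncomputable def semiconvexDual {n : ℕ} (φ : (Fin n → ℝ) → (Fin n → ℝ) → ℝ)
    (p : (Fin n → ℝ) → ℝ) (z : Fin n → ℝ) : EReal :=
  ⨅ x : Fin n → ℝ, ((p x - φ x z : ℝ) : EReal)

/-- One doubling step applied to the triple `(P, S, Q)`, relative to the terminal parameters
`(P₀, S₀, Q₀)`. -/
noncomputable def doublingStep {n : ℕ} (P₀ S₀ Q₀ : Matrix (Fin n) (Fin n) ℝ)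
    (k : Matrix (Fin n) (Fin n) ℝ × Matrix (Fin n) (Fin n) ℝ × Matrix (Fin n) (Fin n) ℝ) :
    Matrix (Fin n) (Fin n) ℝ × Matrix (Fin n) (Fin n) ℝ × Matrix (Fin n) (Fin n) ℝ :=
  let P := k.1
  let S := k.2.1
  let Q := k.2.2
  (P + S * ((Q₀ - Q) + S₀ᵀ * (P - P₀)⁻¹ * S₀)⁻¹ * Sᵀ,
    S * ((Q₀ - Q) + S₀ᵀ * (P - P₀)⁻¹ * S₀)⁻¹ * S₀ᵀ * (P - P₀)⁻¹ * S,
    Q + Sᵀ * ((P₀ - P) + S₀ * (Q - Q₀)⁻¹ * S₀ᵀ)⁻¹ * S)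

end RiccatiDoubling

open RiccatiDoubling

/-! The equations are autonomous, so a time shift of `(P, S, Q)` is again a solution. Everything
reduces to comparing two solutions `(P, S, Q)` and `(p, s, q)` on one interval `[a, b]`. For the
two-time formulas the second is the first shifted by `t₂`, so that its terminal kernel is `φ_{t₂}`.

Write `W = σσ'` and `D = p - P`. Then `-Ḋ = (A + WP)'D + D(A + WP) + DWD`. Since `S` is a
fundamental matrix of the linear part, `E = S⁻¹D(S⁻¹)'` satisfies `-Ė = E(S'WS)E`. Formally `E⁻¹`
has derivative `S'WS = -Q̇`, so `E⁻¹ + Q` is conserved. Hence `E⁻¹` is the matrix `diffMat`, and `p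
= P + S E S'` (`inv_mul_diffMat`, `riccati_eq`). Only invertibility of `D` at time `b` is needed,
which gives the formula for an arbitrary Riccati solution. Uniqueness for linear equations then
identifies `s` (`mixed_eq`) and `q` (`pure_eq`), and `mul_woodbury` brings `q` to the stated form.

The value function identity is a verification argument: along a trajectory the kernel plus the
accumulated payoff decreases by a completed square, which vanishes under the linear feedback
(`payoff_eq`, `exists_optimal`). Convexity enters as positivity of `D`; it propagates backward
because `E` is antitone in time (`isPositive_sub`). Controllability makes `Q a - Q b`, a Gramian,
positive definite (`isPositive_Q_sub`). The dual is conserved because both infima are explicit and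
the conserved quantity `E⁻¹ + Q` matches them (`semiconvexDual_eq`). -/

namespace RiccatiDoubling

/-! ### Matrix calculus and uniqueness for linear differential equations. -/

section Calculus

variable {n m k : ℕ}

theorem hasDerivWithinAt_matrix_iff {X : ℝ → Matrix (Fin n) (Fin m) ℝ}
    {X' : Matrix (Fin n) (Fin m) ℝ} {s : Set ℝ} {t : ℝ} :
    HasDerivWithinAt X X' s t ↔ ∀ i j, HasDerivWithinAt (fun r => X r i j) (X' i j) s t := by
  exact (hasDerivWithinAt_pi (φ := X) (φ' := X')).trans (forall_congr' fun i => hasDerivWithinAt_pi)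

theorem hasDerivWithinAt_matrix_const (s : Set ℝ) (t : ℝ) (X : Matrix (Fin n) (Fin m) ℝ) :
    HasDerivWithinAt (fun _ : ℝ => X) 0 s t := by
  rw [hasDerivWithinAt_matrix_iff]
  exact fun i j => hasDerivWithinAt_const t s (X i j)

theorem _root_.HasDerivWithinAt.matrix_add {X Y : ℝ → Matrix (Fin n) (Fin m) ℝ}
    {X' Y' : Matrix (Fin n) (Fin m) ℝ} {s : Set ℝ} {t : ℝ} (hX : HasDerivWithinAt X X' s t)
    (hY : HasDerivWithinAt Y Y' s t) : HasDerivWithinAt (fun r => X r + Y r) (X' + Y') s t := by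
  rw [hasDerivWithinAt_matrix_iff] at *
  exact fun i j => (hX i j).fun_add (hY i j)

theorem _root_.HasDerivWithinAt.matrix_sub {X Y : ℝ → Matrix (Fin n) (Fin m) ℝ}
    {X' Y' : Matrix (Fin n) (Fin m) ℝ} {s : Set ℝ} {t : ℝ} (hX : HasDerivWithinAt X X' s t)
    (hY : HasDerivWithinAt Y Y' s t) : HasDerivWithinAt (fun r => X r - Y r) (X' - Y') s t := by
  rw [hasDerivWithinAt_matrix_iff] at *
  exact fun i j => (hX i j).fun_sub (hY i j)

theorem _root_.HasDerivWithinAt.matrix_continuousWithinAt {X : ℝ → Matrix (Fin n) (Fin m) ℝ}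
    {X' : Matrix (Fin n) (Fin m) ℝ} {s : Set ℝ} {t : ℝ} (hX : HasDerivWithinAt X X' s t) :
    ContinuousWithinAt X s t := by
  rw [hasDerivWithinAt_matrix_iff] at hX
  exact continuousWithinAt_pi.2 fun i => continuousWithinAt_pi.2 fun j =>
    (hX i j).continuousWithinAt

theorem _root_.HasDerivWithinAt.matrix_mul {X : ℝ → Matrix (Fin n) (Fin m) ℝ}
    {Y : ℝ → Matrix (Fin m) (Fin k) ℝ} {X' : Matrix (Fin n) (Fin m) ℝ}
    {Y' : Matrix (Fin m) (Fin k) ℝ} {s : Set ℝ} {t : ℝ} (hX : HasDerivWithinAt X X' s t)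
    (hY : HasDerivWithinAt Y Y' s t) :
    HasDerivWithinAt (fun r => X r * Y r) (X' * Y t + X t * Y') s t := by
  rw [hasDerivWithinAt_matrix_iff] at *
  intro i j
  have := HasDerivWithinAt.fun_sum (u := Finset.univ) fun l _ => (hX i l).fun_mul (hY l j)
  simpa only [Matrix.mul_apply, Matrix.add_apply, ← Finset.sum_add_distrib] using this

theorem _root_.HasDerivWithinAt.matrix_transpose {X : ℝ → Matrix (Fin n) (Fin m) ℝ}
    {X' : Matrix (Fin n) (Fin m) ℝ} {s : Set ℝ} {t : ℝ} (hX : HasDerivWithinAt X X' s t) :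
    HasDerivWithinAt (fun r => (X r)ᵀ) X'ᵀ s t := by
  rw [hasDerivWithinAt_matrix_iff] at *
  exact fun i j => hX j i

theorem _root_.HasDerivWithinAt.matrix_mulVec {X : ℝ → Matrix (Fin n) (Fin m) ℝ}
    {v : ℝ → Fin m → ℝ} {X' : Matrix (Fin n) (Fin m) ℝ} {v' : Fin m → ℝ} {s : Set ℝ} {t : ℝ}
    (hX : HasDerivWithinAt X X' s t) (hv : HasDerivWithinAt v v' s t) :
    HasDerivWithinAt (fun r => X r *ᵥ v r) (X' *ᵥ v t + X t *ᵥ v') s t := by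
  rw [hasDerivWithinAt_matrix_iff] at hX
  rw [hasDerivWithinAt_pi] at *
  intro i
  have := HasDerivWithinAt.fun_sum (u := Finset.univ) fun l _ => (hX i l).fun_mul (hv l)
  simpa only [Matrix.mulVec, dotProduct, Pi.add_apply, ← Finset.sum_add_distrib] using this

theorem _root_.HasDerivWithinAt.dotProduct {v w : ℝ → Fin n → ℝ} {v' w' : Fin n → ℝ} {s : Set ℝ}
    {t : ℝ} (hv : HasDerivWithinAt v v' s t) (hw : HasDerivWithinAt w w' s t) :
    HasDerivWithinAt (fun r => v r ⬝ᵥ w r) (v' ⬝ᵥ w t + v t ⬝ᵥ w') s t := by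
  rw [hasDerivWithinAt_pi] at *
  have := HasDerivWithinAt.fun_sum (u := Finset.univ) fun l _ => (hv l).fun_mul (hw l)
  simpa only [_root_.dotProduct, Pi.add_apply, ← Finset.sum_add_distrib] using this

-- The operator norm makes square matrices a normed algebra, in which ring inversion has a known
-- derivative.
open scoped Matrix.Norms.Operator in
theorem _root_.HasDerivWithinAt.matrix_inv {X : ℝ → Matrix (Fin n) (Fin n) ℝ}
    {X' : Matrix (Fin n) (Fin n) ℝ} {s : Set ℝ} {t : ℝ} (hX : HasDerivWithinAt X X' s t)
    (hu : IsUnit (X t)) :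
    HasDerivWithinAt (fun r => (X r)⁻¹) (-((X t)⁻¹ * X' * (X t)⁻¹)) s t := by
  obtain ⟨u, hu⟩ := hu
  have h := (hasFDerivAt_ringInverse (𝕜 := ℝ) u)
  rw [hu] at h
  have := h.comp_hasDerivWithinAt t hX
  simp only [Matrix.nonsing_inv_eq_ringInverse]
  convert! this using 1
  simp [← hu]

/-- A function satisfying a linear differential inequality and vanishing somewhere vanishes
identically. -/
theorem eq_zero_of_norm_deriv_le {E : Type*} [NormedAddCommGroup E] [NormedSpace ℝ E]
    {f f' : ℝ → E} {K a b c : ℝ} (hf : ∀ t ∈ Icc a b, HasDerivWithinAt f (f' t) (Icc a b) t)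
    (hK : ∀ t ∈ Icc a b, ‖f' t‖ ≤ K * ‖f t‖) (hc : c ∈ Icc a b) (h0 : f c = 0) :
    ∀ t ∈ Icc a b, f t = 0 := by
  have right : ∀ (g g' : ℝ → E) (a b : ℝ),
      (∀ t ∈ Icc a b, HasDerivWithinAt g (g' t) (Icc a b) t) →
      (∀ t ∈ Icc a b, ‖g' t‖ ≤ K * ‖g t‖) → g a = 0 → ∀ t ∈ Icc a b, g t = 0 := by
    intro g g' a b hg hg' h0
    refine eq_zero_of_abs_deriv_le_mul_abs_self_of_eq_zero_right
      (fun t ht => (hg t ht).continuousWithinAt) (fun t ht => ?_) h0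
      (fun t ht => hg' t (Ico_subset_Icc_self ht))
    exact (hg t (Ico_subset_Icc_self ht)).mono_of_mem_nhdsWithin (Icc_mem_nhdsGE_of_mem ht)
  intro t ht
  rcases le_total c t with h | h
  · exact right f f' c b
      (fun r hr => (hf r ⟨hc.1.trans hr.1, hr.2⟩).mono (Icc_subset_Icc_left hc.1))
      (fun r hr => hK r ⟨hc.1.trans hr.1, hr.2⟩) h0 t ⟨h, ht.2⟩
  -- Times before `c` reduce to the forward case by reversing time.
  · have := right (fun r => f (-r)) (fun r => -f' (-r)) (-c) (-a) ?_ ?_ (by simpa using h0) (-t)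
      ⟨by linarith, by linarith [ht.1]⟩
    · simpa using this
    · intro r hr
      have hr' : -r ∈ Icc a c := ⟨by linarith [hr.2], by linarith [hr.1]⟩
      have h1 := hf (-r) ⟨hr'.1, hr'.2.trans hc.2⟩
      have h2 : HasDerivWithinAt (fun r : ℝ => -r) (-1) (Icc (-c) (-a)) r :=
        (hasDerivAt_neg r).hasDerivWithinAt
      have h3 := h1.scomp r h2 (fun w hw => ⟨by linarith [hw.2], by linarith [hw.1, hc.2]⟩)
      simpa [Function.comp_def] using h3
    · intro r hr
      simpa using hK (-r) ⟨by linarith [hr.2], by linarith [hr.1, hc.2]⟩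

open scoped Matrix.Norms.Operator in
/-- A solution of `Ẋ = L X + X R` that vanishes somewhere vanishes identically. -/
theorem eq_zero_of_linear_ode {L : ℝ → Matrix (Fin n) (Fin n) ℝ} {R : ℝ → Matrix (Fin m) (Fin m) ℝ}
    {X : ℝ → Matrix (Fin n) (Fin m) ℝ} {a b c : ℝ} (hL : ContinuousOn L (Icc a b))
    (hR : ContinuousOn R (Icc a b))
    (hX : ∀ t ∈ Icc a b, HasDerivWithinAt X (L t * X t + X t * R t) (Icc a b) t)
    (hc : c ∈ Icc a b) (h0 : X c = 0) : ∀ t ∈ Icc a b, X t = 0 := by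
  obtain ⟨K₁, hK₁⟩ := isCompact_Icc.exists_bound_of_continuousOn hL
  obtain ⟨K₂, hK₂⟩ := isCompact_Icc.exists_bound_of_continuousOn hR
  refine eq_zero_of_norm_deriv_le (K := K₁ + K₂) hX (fun t ht => ?_) hc h0
  calc ‖L t * X t + X t * R t‖ ≤ ‖L t‖ * ‖X t‖ + ‖X t‖ * ‖R t‖ :=
        (norm_add_le _ _).trans (add_le_add (Matrix.linfty_opNorm_mul _ _)
          (Matrix.linfty_opNorm_mul _ _))
    _ ≤ K₁ * ‖X t‖ + ‖X t‖ * K₂ := by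
        gcongr
        · exact hK₁ t ht
        · exact hK₂ t ht
    _ = (K₁ + K₂) * ‖X t‖ := by ring

end Calculus

/-! ### Algebra of two solutions of the Riccati system. -/

section Flow

variable {n : ℕ}

/-- `-ṗ = A'p + pA + C + p W p` on `[a, b]`, as an equation between matrices. -/
def IsRiccatiOn (A C W : Matrix (Fin n) (Fin n) ℝ) (a b : ℝ)
    (p : ℝ → Matrix (Fin n) (Fin n) ℝ) : Prop :=
  ∀ t ∈ Icc a b,
    HasDerivWithinAt p (-(Aᵀ * p t + p t * A + C + p t * W * p t)) (Icc a b) t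

/-- A solution `(P, S, Q)` on `[a, b]` of the Riccati equations for a bivariate quadratic, with
`P`, `Q` symmetric and `S` invertible. -/
structure IsKernelFlow (A C W : Matrix (Fin n) (Fin n) ℝ) (a b : ℝ)
    (P S Q : ℝ → Matrix (Fin n) (Fin n) ℝ) : Prop where
  symmC : Cᵀ = C
  symmW : Wᵀ = W
  derivP : IsRiccatiOn A C W a b P
  derivS : ∀ t ∈ Icc a b, HasDerivWithinAt S (-((A + W * P t)ᵀ * S t)) (Icc a b) t
  derivQ : ∀ t ∈ Icc a b, HasDerivWithinAt Q (-((S t)ᵀ * W * S t)) (Icc a b) t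
  symmP : ∀ t ∈ Icc a b, (P t)ᵀ = P t
  symmQ : ∀ t ∈ Icc a b, (Q t)ᵀ = Q t
  unitS : ∀ t ∈ Icc a b, IsUnit (S t)

variable {A C W : Matrix (Fin n) (Fin n) ℝ} {a b : ℝ} {P S Q p s q : ℝ → Matrix (Fin n) (Fin n) ℝ}

theorem hasDerivWithinAt_shift {F : Type*} [NormedAddCommGroup F] [NormedSpace ℝ F] {f : ℝ → F}
    {f' : F} {a' b' c t : ℝ} (ha : a ≤ a' + c) (hb : b' + c ≤ b)
    (hf : HasDerivWithinAt f f' (Icc a b) (t + c)) :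
    HasDerivWithinAt (fun r => f (r + c)) f' (Icc a' b') t := by
  have h1 : HasDerivWithinAt (fun r : ℝ => r + c) 1 (Icc a' b') t :=
    ((hasDerivAt_id t).add_const c).hasDerivWithinAt
  simpa [Function.comp_def] using
    hf.scomp t h1 (fun w (hw : w ∈ Icc a' b') =>
      (⟨by linarith [hw.1], by linarith [hw.2]⟩ : w + c ∈ Icc a b))

theorem hasDerivWithinAt_matrix_shift {f : ℝ → Matrix (Fin n) (Fin n) ℝ}
    {f' : Matrix (Fin n) (Fin n) ℝ} {a' b' c t : ℝ} (ha : a ≤ a' + c) (hb : b' + c ≤ b)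
    (hf : HasDerivWithinAt f f' (Icc a b) (t + c)) :
    HasDerivWithinAt (fun r => f (r + c)) f' (Icc a' b') t := by
  rw [hasDerivWithinAt_matrix_iff] at *
  exact fun i j => hasDerivWithinAt_shift ha hb (hf i j)

theorem IsRiccatiOn.shift (h : IsRiccatiOn A C W a b p) {a' b' c : ℝ} (ha : a ≤ a' + c)
    (hb : b' + c ≤ b) : IsRiccatiOn A C W a' b' (fun r => p (r + c)) := fun t ht =>
  hasDerivWithinAt_matrix_shift ha hb (h (t + c) ⟨by linarith [ht.1], by linarith [ht.2]⟩)

/-- The equations are autonomous. The shift turns the kernel at an earlier time into terminal data,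
which makes it comparable with the original flow. -/
theorem IsKernelFlow.shift (h : IsKernelFlow A C W a b P S Q) {a' b' c : ℝ} (ha : a ≤ a' + c)
    (hb : b' + c ≤ b) :
    IsKernelFlow A C W a' b' (fun r => P (r + c)) (fun r => S (r + c)) (fun r => Q (r + c)) := by
  have hm : ∀ t ∈ Icc a' b', t + c ∈ Icc a b := fun t ht =>
    ⟨by linarith [ht.1], by linarith [ht.2]⟩
  exact
    { symmC := h.symmC
      symmW := h.symmW
      derivP := h.derivP.shift ha hb
      derivS := fun t ht => hasDerivWithinAt_matrix_shift ha hb (h.derivS _ (hm t ht))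
      derivQ := fun t ht => hasDerivWithinAt_matrix_shift ha hb (h.derivQ _ (hm t ht))
      symmP := fun t ht => h.symmP _ (hm t ht)
      symmQ := fun t ht => h.symmQ _ (hm t ht)
      unitS := fun t ht => h.unitS _ (hm t ht) }

theorem IsKernelFlow.mono (h : IsKernelFlow A C W a b P S Q) {a' b' : ℝ} (ha : a ≤ a')
    (hb : b' ≤ b) : IsKernelFlow A C W a' b' P S Q := by
  simpa using h.shift (c := 0) (a' := a') (b' := b') (by simpa using ha) (by simpa using hb)

theorem IsRiccatiOn.continuousOn (h : IsRiccatiOn A C W a b p) : ContinuousOn p (Icc a b) :=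
  fun t ht => (h t ht).matrix_continuousWithinAt

theorem IsKernelFlow.continuousOn_S (h : IsKernelFlow A C W a b P S Q) :
    ContinuousOn S (Icc a b) :=
  fun t ht => (h.derivS t ht).matrix_continuousWithinAt

/-- As `C` and `W` are symmetric, `pᵀ` solves the same equation. The quadratic terms telescope as
`pᵀW(pᵀ - p) + (pᵀ - p)Wp`, so the difference solves a linear equation. -/
theorem IsRiccatiOn.transpose_eq (hp : IsRiccatiOn A C W a b p) (hC : Cᵀ = C) (hW : Wᵀ = W)
    (hb : (p b)ᵀ = p b) : ∀ t ∈ Icc a b, (p t)ᵀ = p t := by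
  intro t ht
  have hc := hp.continuousOn
  have := eq_zero_of_linear_ode (X := fun r => (p r)ᵀ - p r) (a := a) (b := b) (c := b)
    (L := fun r => -(Aᵀ + (p r)ᵀ * W)) (R := fun r => -(A + W * p r))
    (by fun_prop) (by fun_prop) (fun r hr => ?_) ⟨ht.1.trans ht.2, le_rfl⟩ (by simp [hb]) t ht
  · exact sub_eq_zero.1 this
  · convert! (hp r hr).matrix_transpose.matrix_sub (hp r hr) using 1
    simp only [transpose_neg, transpose_add, transpose_mul, transpose_transpose, hC, hW]
    noncomm_ring

/-- Assembles the data of an `IsKernelFlow` from the differential equations and the terminal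
conditions. -/
theorem IsKernelFlow.of_terminal (hab : a ≤ b) (hC : Cᵀ = C) (hW : Wᵀ = W)
    (hP : IsRiccatiOn A C W a b P)
    (hS : ∀ t ∈ Icc a b, HasDerivWithinAt S (-((A + W * P t)ᵀ * S t)) (Icc a b) t)
    (hQ : ∀ t ∈ Icc a b, HasDerivWithinAt Q (-((S t)ᵀ * W * S t)) (Icc a b) t)
    (hPb : (P b)ᵀ = P b) (hQb : (Q b)ᵀ = Q b) (hSb : IsUnit (S b)) :
    IsKernelFlow A C W a b P S Q where
  symmC := hC
  symmW := hW
  derivP := hP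
  derivS := hS
  derivQ := hQ
  symmP := hP.transpose_eq hC hW hPb
  symmQ := by
    intro t ht
    have := eq_zero_of_linear_ode (X := fun r => (Q r)ᵀ - Q r) (a := a) (b := b) (c := b)
      (L := fun r => 0) (R := fun r => 0)
      (by fun_prop) (by fun_prop) (fun r hr => ?_) ⟨hab, le_rfl⟩ (by simp [hQb]) t ht
    · exact sub_eq_zero.1 this
    · convert! (hQ r hr).matrix_transpose.matrix_sub (hQ r hr) using 1
      simp only [transpose_neg, transpose_mul, transpose_transpose, hW]
      noncomm_ring
  unitS := by
    intro t ht
    rw [← Matrix.mulVec_injective_iff_isUnit]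
    refine (injective_iff_map_eq_zero (S t).mulVecLin).2 fun v hv => ?_
    have hPc := hP.continuousOn
    -- A kernel vector of `S t` stays in the kernel at all times, by uniqueness run forward from
    -- `t`. It is written as a one-column matrix to fit `eq_zero_of_linear_ode`.
    have h0 : S b * Matrix.replicateCol (Fin 1) v = 0 := by
      refine eq_zero_of_linear_ode (X := fun r => S r * Matrix.replicateCol (Fin 1) v) (a := a)
        (b := b) (c := t) (L := fun r => -(A + W * P r)ᵀ) (R := fun r => 0) (by fun_prop)
        (by fun_prop) (fun r hr => ?_) ht ?_ b ⟨hab, le_rfl⟩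
      · convert! (hS r hr).matrix_mul (hasDerivWithinAt_matrix_const _ r _) using 1
        simp only [Matrix.neg_mul, Matrix.mul_assoc, Matrix.mul_zero]
      · rw [← Matrix.replicateCol_mulVec]
        have : S t *ᵥ v = 0 := hv
        simp [this]
    have h1 : S b *ᵥ v = 0 := by
      rw [← Matrix.replicateCol_mulVec] at h0
      simpa using h0
    exact Matrix.mulVec_injective_of_isUnit hSb (by simpa using h1)

/-- The matrix `S_b'(p_b - P_b)⁻¹S_b + Q_b - Q_t`, whose inverse describes the difference of two
solutions of the Riccati equation. -/
noncomputable def diffMat (P S Q p : ℝ → Matrix (Fin n) (Fin n) ℝ) (b t : ℝ) :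
    Matrix (Fin n) (Fin n) ℝ :=
  (S b)ᵀ * (p b - P b)⁻¹ * S b + Q b - Q t

theorem hasDerivWithinAt_diffMat (h : IsKernelFlow A C W a b P S Q) {t : ℝ} (ht : t ∈ Icc a b) :
    HasDerivWithinAt (diffMat P S Q p b) ((S t)ᵀ * W * S t) (Icc a b) t := by
  have := (hasDerivWithinAt_matrix_const _ t ((S b)ᵀ * (p b - P b)⁻¹ * S b + Q b)).matrix_sub
    (h.derivQ t ht)
  rwa [zero_sub, neg_neg] at this

theorem IsKernelFlow.hasDerivWithinAt_inv (h : IsKernelFlow A C W a b P S Q) {t : ℝ}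
    (ht : t ∈ Icc a b) :
    HasDerivWithinAt (fun r => (S r)⁻¹) ((S t)⁻¹ * (A + W * P t)ᵀ) (Icc a b) t := by
  have hS := Matrix.mul_nonsing_inv (S t) ((Matrix.isUnit_iff_isUnit_det _).1 (h.unitS t ht))
  convert! (h.derivS t ht).matrix_inv (h.unitS t ht) using 1
  rw [Matrix.mul_neg, Matrix.neg_mul, neg_neg, Matrix.mul_assoc, Matrix.mul_assoc, hS,
    Matrix.mul_one]

/-- With `E = S⁻¹(p - P)(S⁻¹)'` and `M = diffMat`, one has `Ė = -E(S'WS)E` and `Ṁ = S'WS`, so `EM -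
1` solves the linear equation `Ẋ = -E(S'WS)X` and vanishes at `b`. Nothing is inverted on the way,
so invertibility of `M` throughout the interval is a consequence. -/
theorem IsKernelFlow.inv_mul_diffMat (h : IsKernelFlow A C W a b P S Q)
    (hp : IsRiccatiOn A C W a b p) (hu : IsUnit (p b - P b)) :
    ∀ t ∈ Icc a b, (S t)⁻¹ * (p t - P t) * (S t)⁻¹ᵀ * diffMat P S Q p b t = 1 := by
  intro t ht
  have hb : b ∈ Icc a b := ⟨ht.1.trans ht.2, le_rfl⟩
  have hT := fun r hr => h.hasDerivWithinAt_inv (t := r) hr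
  have hTc : ContinuousOn (fun r => (S r)⁻¹) (Icc a b) := fun r hr => (hT r hr).matrix_continuousWithinAt
  have hSc := h.continuousOn_S
  have hpc := hp.continuousOn
  have hPc := h.derivP.continuousOn
  rw [← sub_eq_zero]
  refine eq_zero_of_linear_ode
    (X := fun r => (S r)⁻¹ * (p r - P r) * (S r)⁻¹ᵀ * diffMat P S Q p b r - 1)
    (a := a) (b := b) (c := b) (L := fun r => -((S r)⁻¹ * (p r - P r) * W * S r))
    (R := fun r => 0) (by fun_prop) (by fun_prop) (fun r hr => ?_) hb ?_ t ht
  · have hd := ((((hT r hr).matrix_mul ((hp r hr).matrix_sub (h.derivP r hr))).matrix_mul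
      (hT r hr).matrix_transpose).matrix_mul
        (hasDerivWithinAt_diffMat (p := p) h hr)).matrix_sub
        (hasDerivWithinAt_matrix_const _ r 1)
    convert! hd using 1
    have hS := Matrix.mul_nonsing_inv (S r) ((Matrix.isUnit_iff_isUnit_det _).1 (h.unitS r hr))
    have hS' := congrArg Matrix.transpose hS
    generalize (S r)⁻¹ = T at *
    obtain ⟨D, hD⟩ : ∃ D, p r = P r + D := ⟨p r - P r, by abel⟩
    simp only [transpose_mul, transpose_transpose, transpose_add, transpose_one, h.symmW,
      h.symmP r hr, hD] at hS' ⊢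
    generalize diffMat P S Q p b r = M
    have e1 : ∀ Y, S r * (T * Y) = Y := fun Y => by rw [← Matrix.mul_assoc, hS, Matrix.one_mul]
    have e2 : ∀ Y, Tᵀ * ((S r)ᵀ * Y) = Y := fun Y => by
      rw [← Matrix.mul_assoc, hS', Matrix.one_mul]
    simp only [Matrix.mul_add, Matrix.add_mul, Matrix.mul_sub, Matrix.sub_mul, Matrix.neg_mul,
      Matrix.mul_neg, Matrix.mul_assoc, e1, e2, Matrix.mul_one, Matrix.mul_zero]
    noncomm_ring
  · have hS := Matrix.nonsing_inv_mul (S b) ((Matrix.isUnit_iff_isUnit_det _).1 (h.unitS b hb))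
    have hS2 := congrArg Matrix.transpose
      (Matrix.mul_nonsing_inv (S b) ((Matrix.isUnit_iff_isUnit_det _).1 (h.unitS b hb)))
    have hD := Matrix.mul_nonsing_inv _ ((Matrix.isUnit_iff_isUnit_det _).1 hu)
    simp only [diffMat, add_sub_cancel_right, sub_eq_zero]
    rw [transpose_mul, transpose_one] at hS2
    calc (S b)⁻¹ * (p b - P b) * (S b)⁻¹ᵀ * ((S b)ᵀ * (p b - P b)⁻¹ * S b)
        = (S b)⁻¹ * ((p b - P b) * ((S b)⁻¹ᵀ * (S b)ᵀ) * (p b - P b)⁻¹) * S b := by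
          simp only [Matrix.mul_assoc]
      _ = 1 := by rw [hS2, Matrix.mul_one, hD, Matrix.mul_one, hS]

theorem IsKernelFlow.isUnit_diffMat (h : IsKernelFlow A C W a b P S Q)
    (hp : IsRiccatiOn A C W a b p) (hu : IsUnit (p b - P b)) :
    ∀ t ∈ Icc a b, IsUnit (diffMat P S Q p b t) := fun t ht =>
  IsUnit.of_mul_eq_one_right _ (h.inv_mul_diffMat hp hu t ht)

/-- The difference of two solutions of the Riccati equation. -/
theorem IsKernelFlow.riccati_eq (h : IsKernelFlow A C W a b P S Q)
    (hp : IsRiccatiOn A C W a b p) (hu : IsUnit (p b - P b)) :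
    ∀ t ∈ Icc a b, p t = P t + S t * (diffMat P S Q p b t)⁻¹ * (S t)ᵀ := by
  intro t ht
  have h1 := h.inv_mul_diffMat hp hu t ht
  have hS := Matrix.mul_nonsing_inv (S t) ((Matrix.isUnit_iff_isUnit_det _).1 (h.unitS t ht))
  have hS2 := congrArg Matrix.transpose hS
  rw [transpose_mul, transpose_one] at hS2
  rw [Matrix.inv_eq_left_inv h1]
  calc p t = P t + (S t * (S t)⁻¹) * (p t - P t) * ((S t)⁻¹ᵀ * (S t)ᵀ) := by
        rw [hS, hS2, Matrix.one_mul, Matrix.mul_one]; abel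
    _ = _ := by simp only [Matrix.mul_assoc]

theorem IsKernelFlow.hasDerivWithinAt_inv_diffMat (h : IsKernelFlow A C W a b P S Q)
    (hp : IsRiccatiOn A C W a b p) (hu : IsUnit (p b - P b)) {t : ℝ} (ht : t ∈ Icc a b) :
    HasDerivWithinAt (fun r => (diffMat P S Q p b r)⁻¹)
      (-((diffMat P S Q p b t)⁻¹ * ((S t)ᵀ * W * S t) * (diffMat P S Q p b t)⁻¹)) (Icc a b) t :=
  (hasDerivWithinAt_diffMat h ht).matrix_inv (h.isUnit_diffMat hp hu t ht)

theorem IsKernelFlow.transpose_diffMat (h : IsKernelFlow A C W a b P S Q)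
    (hpb : (p b)ᵀ = p b) {t : ℝ} (ht : t ∈ Icc a b) :
    (diffMat P S Q p b t)ᵀ = diffMat P S Q p b t := by
  have hb : b ∈ Icc a b := ⟨ht.1.trans ht.2, le_rfl⟩
  simp only [diffMat, transpose_sub, transpose_add, transpose_mul, transpose_transpose,
    transpose_nonsing_inv, hpb, h.symmP b hb, h.symmQ b hb, h.symmQ t ht, Matrix.mul_assoc]

/-- The mixed coefficient of a second kernel in terms of the first. -/
theorem IsKernelFlow.mixed_eq (h : IsKernelFlow A C W a b P S Q)
    (h' : IsKernelFlow A C W a b p s q) (hu : IsUnit (p b - P b)) :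
    ∀ t ∈ Icc a b,
      s t = S t * (diffMat P S Q p b t)⁻¹ * ((S b)ᵀ * (p b - P b)⁻¹ * s b) := by
  intro t ht
  have hb : b ∈ Icc a b := ⟨ht.1.trans ht.2, le_rfl⟩
  have hpc := h'.derivP.continuousOn
  rw [← sub_eq_zero]
  refine eq_zero_of_linear_ode (X := fun r => s r - S r * (diffMat P S Q p b r)⁻¹ *
    ((S b)ᵀ * (p b - P b)⁻¹ * s b)) (a := a) (b := b) (c := b)
    (L := fun r => -(A + W * p r)ᵀ) (R := fun r => 0) (by fun_prop) (by fun_prop)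
    (fun r hr => ?_) hb ?_ t ht
  · have hd := (h'.derivS r hr).matrix_sub (((h.derivS r hr).matrix_mul
      (h.hasDerivWithinAt_inv_diffMat h'.derivP hu hr)).matrix_mul
        (hasDerivWithinAt_matrix_const _ r ((S b)ᵀ * (p b - P b)⁻¹ * s b)))
    -- Substituting `p = P + S M⁻¹ S'` shows that the candidate solves the same linear equation as
    -- `s`.
    convert! hd using 1
    have e := h.riccati_eq h'.derivP hu r hr
    have e' : (p r)ᵀ = P r + S r * (diffMat P S Q p b r)⁻¹ * (S r)ᵀ := by
      rw [h'.symmP r hr, e]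
    simp only [transpose_add, transpose_mul, h.symmW, h.symmP r hr, e']
    generalize (diffMat P S Q p b r)⁻¹ = E
    noncomm_ring
  · have hSb := (Matrix.isUnit_iff_isUnit_det _).1 (h.unitS b hb)
    have hD := (Matrix.isUnit_iff_isUnit_det _).1 hu
    have hST : IsUnit (S b)ᵀ.det := by rwa [Matrix.det_transpose]
    have e : diffMat P S Q p b b = (S b)ᵀ * (p b - P b)⁻¹ * S b := by simp [diffMat]
    rw [e, Matrix.mul_inv_rev, Matrix.mul_inv_rev, Matrix.nonsing_inv_nonsing_inv _ hD, sub_eq_zero]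
    simp only [Matrix.mul_assoc]
    rw [Matrix.nonsing_inv_mul_cancel_left _ _ hST, Matrix.mul_nonsing_inv_cancel_left _ _ hD,
      Matrix.mul_nonsing_inv_cancel_left _ _ hSb]

/-- The pure coefficient in the second variable of a second kernel in terms of the first. -/
theorem IsKernelFlow.pure_eq (h : IsKernelFlow A C W a b P S Q)
    (h' : IsKernelFlow A C W a b p s q) (hu : IsUnit (p b - P b)) :
    ∀ t ∈ Icc a b,
      q t = q b + ((S b)ᵀ * (p b - P b)⁻¹ * s b)ᵀ *
        ((diffMat P S Q p b t)⁻¹ - (diffMat P S Q p b b)⁻¹) *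
          ((S b)ᵀ * (p b - P b)⁻¹ * s b) := by
  intro t ht
  have hb : b ∈ Icc a b := ⟨ht.1.trans ht.2, le_rfl⟩
  set K := (S b)ᵀ * (p b - P b)⁻¹ * s b with hK
  rw [← sub_eq_zero]
  refine eq_zero_of_linear_ode (X := fun r => q r - (q b + Kᵀ *
    ((diffMat P S Q p b r)⁻¹ - (diffMat P S Q p b b)⁻¹) * K)) (a := a) (b := b) (c := b)
    (L := fun r => 0) (R := fun r => 0) (by fun_prop) (by fun_prop)
    (fun r hr => ?_) hb (by simp) t ht
  have hd := (h'.derivQ r hr).matrix_sub ((hasDerivWithinAt_matrix_const _ r (q b)).matrix_add (((hasDerivWithinAt_matrix_const _ r Kᵀ).matrix_mul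
      ((h.hasDerivWithinAt_inv_diffMat h'.derivP hu hr).matrix_sub
        (hasDerivWithinAt_matrix_const _ r (diffMat P S Q p b b)⁻¹))).matrix_mul
          (hasDerivWithinAt_matrix_const _ r K)))
  -- By `mixed_eq`, `s = S M⁻¹ K`, so `q̇ = -s'Ws = K'(M⁻¹)˙K`, and the difference has zero
  -- derivative.
  convert! hd using 1
  have e := h.mixed_eq h' hu r hr
  rw [← hK] at e
  have e' : ((diffMat P S Q p b r)⁻¹)ᵀ = (diffMat P S Q p b r)⁻¹ := by
    rw [transpose_nonsing_inv, h.transpose_diffMat (h'.symmP b hb) hr]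
  simp only [e, transpose_mul, e']
  generalize (diffMat P S Q p b r)⁻¹ = E
  noncomm_ring

end Flow

/-! ### Absolute continuity and the fundamental theorem of calculus almost everywhere. -/

section AbsolutelyContinuous

variable {f g : ℝ → ℝ} {a b : ℝ}

theorem absolutelyContinuousOnInterval_congr (hf : AbsolutelyContinuousOnInterval f a b)
    (h : EqOn f g (uIcc a b)) : AbsolutelyContinuousOnInterval g a b := by
  rw [absolutelyContinuousOnInterval_iff] at *
  intro ε hε
  obtain ⟨δ, hδ, H⟩ := hf ε hε
  refine ⟨δ, hδ, fun E hE hlt => ?_⟩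
  convert! H E hE hlt using 1
  refine Finset.sum_congr rfl fun i hi => ?_
  rw [h (hE.1 i hi).1, h (hE.1 i hi).2]

theorem absolutelyContinuousOnInterval_const (c : ℝ) :
    AbsolutelyContinuousOnInterval (fun _ => c) a b := by
  rw [absolutelyContinuousOnInterval_iff]
  exact fun ε hε => ⟨1, one_pos, fun E _ _ => by simpa using hε⟩

theorem absolutelyContinuousOnInterval_sum {ι : Type*} (s : Finset ι) {F : ι → ℝ → ℝ}
    (h : ∀ i ∈ s, AbsolutelyContinuousOnInterval (F i) a b) :
    AbsolutelyContinuousOnInterval (fun r => ∑ i ∈ s, F i r) a b := by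
  classical
  induction s using Finset.induction_on with
  | empty => simpa using absolutelyContinuousOnInterval_const 0
  | insert i s hi ih =>
    simp only [Finset.sum_insert hi]
    exact (h i (Finset.mem_insert_self i s)).add
      (ih fun j hj => h j (Finset.mem_insert_of_mem hj))

theorem absolutelyContinuousOnInterval_of_hasDerivWithinAt (hab : a ≤ b)
    (hf : ∀ t ∈ Icc a b, HasDerivWithinAt f (g t) (Icc a b) t) (hg : ContinuousOn g (Icc a b)) :
    AbsolutelyContinuousOnInterval f a b := by
  obtain ⟨K, hK⟩ := isCompact_Icc.exists_bound_of_continuousOn hg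
  have : LipschitzOnWith K.toNNReal f (Icc a b) := by
    refine (convex_Icc a b).lipschitzOnWith_of_nnnorm_hasDerivWithin_le hf fun t ht => ?_
    rw [← NNReal.coe_le_coe, coe_nnnorm]
    exact (hK t ht).trans (Real.le_coe_toNNReal K)
  rw [← uIcc_of_le hab] at this
  exact this.absolutelyContinuousOnInterval

/-- Controls are only square integrable, so quantities along a trajectory are differentiable only
almost everywhere; absolute continuity is what allows them to be recovered from the derivative. -/
theorem integral_eq_sub_of_ae_hasDerivAt (hab : a ≤ b)
    (hf : AbsolutelyContinuousOnInterval f a b)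
    (hg : ∀ᵐ r, r ∈ Ioo a b → HasDerivAt f (g r) r) :
    IntervalIntegrable g volume a b ∧ ∫ r in a..b, g r = f b - f a := by
  have hne : ∀ᵐ r : ℝ, r ≠ b := Measure.ae_ne volume b
  have h : ∀ᵐ r, r ∈ uIoc a b → deriv f r = g r := by
    filter_upwards [hg, hne] with r hr hrb hm
    rw [uIoc_of_le hab] at hm
    exact (hr ⟨hm.1, lt_of_le_of_ne hm.2 hrb⟩).deriv
  refine ⟨hf.intervalIntegrable_deriv.congr_ae ?_, ?_⟩
  · exact (ae_restrict_iff' measurableSet_uIoc).2 h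
  · rw [← hf.integral_deriv_eq_sub]
    exact (intervalIntegral.integral_congr_ae h).symm

end AbsolutelyContinuous

/-! ### Regularity of controlled trajectories. -/

section Trajectory

variable {n m : ℕ} {A C : Matrix (Fin n) (Fin n) ℝ} {σ : Matrix (Fin n) (Fin m) ℝ} {a b : ℝ}
  {u : ℝ → Fin m → ℝ} {x : ℝ → Fin n → ℝ}

theorem IsTrajectory.memLp_control (h : IsTrajectory A σ a b u x) (j : Fin m) :
    MemLp (fun r => u r j) 2 (volume.restrict (Icc a b)) := by
  have := (ContinuousLinearMap.proj (R := ℝ) (φ := fun _ : Fin m => ℝ) j).comp_memLp' h.control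
  exact this

theorem IsTrajectory.continuousOn_apply (h : IsTrajectory A σ a b u x) (i : Fin n) :
    ContinuousOn (fun r => x r i) (Icc a b) :=
  (continuous_apply i).comp_continuousOn h.continuous

theorem intervalIntegrable_iff_integrable_Icc {f : ℝ → ℝ} (hab : a ≤ b) :
    IntervalIntegrable f volume a b ↔ Integrable f (volume.restrict (Icc a b)) := by
  rw [intervalIntegrable_iff_integrableOn_Icc_of_le hab, IntegrableOn]

theorem IsTrajectory.intervalIntegrable (h : IsTrajectory A σ a b u x) (hab : a ≤ b) (i : Fin n) :
    IntervalIntegrable (fun w => (A *ᵥ x w + σ *ᵥ u w) i) volume a b := by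
  simp only [Pi.add_apply, Matrix.mulVec, dotProduct]
  refine IntervalIntegrable.add ?_ ?_
  · refine ContinuousOn.intervalIntegrable_of_Icc hab ?_
    exact continuousOn_finsetSum _ fun j _ => continuousOn_const.mul (h.continuousOn_apply j)
  · rw [intervalIntegrable_iff_integrable_Icc hab]
    exact integrable_finsetSum _ fun j _ => ((h.memLp_control j).integrable (by norm_num)).const_mul _

theorem IsTrajectory.apply_eq (h : IsTrajectory A σ a b u x) (hab : a ≤ b) (i : Fin n) {r : ℝ}
    (hr : r ∈ Icc a b) : x r i = x a i + ∫ w in a..r, (A *ᵥ x w + σ *ᵥ u w) i := by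
  have hint : IntervalIntegrable (fun w => A *ᵥ x w + σ *ᵥ u w) volume a r := by
    have : IntervalIntegrable (fun w => A *ᵥ x w + σ *ᵥ u w) volume a b := by
      rw [intervalIntegrable_iff_integrableOn_Icc_of_le hab]
      refine Integrable.of_eval fun i => ?_
      exact (intervalIntegrable_iff_integrable_Icc hab).1 (h.intervalIntegrable hab i)
    exact this.mono_set (by rw [uIcc_of_le hab, uIcc_of_le hr.1]; exact Icc_subset_Icc_right hr.2)
  have := (ContinuousLinearMap.proj (R := ℝ) (φ := fun _ : Fin n => ℝ) i).intervalIntegral_comp_comm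
    hint
  simp only [ContinuousLinearMap.proj_apply] at this
  rw [this, ← Pi.add_apply, ← h.dynamics r hr]

theorem IsTrajectory.absolutelyContinuous (h : IsTrajectory A σ a b u x) (hab : a ≤ b) (i : Fin n) :
    AbsolutelyContinuousOnInterval (fun r => x r i) a b := by
  refine absolutelyContinuousOnInterval_congr
    ((absolutelyContinuousOnInterval_const (x a i)).add
      ((h.intervalIntegrable hab i).absolutelyContinuousOnInterval_intervalIntegral
        left_mem_uIcc)) fun r hr => ?_
  rw [uIcc_of_le hab] at hr
  exact (h.apply_eq hab i hr).symm

theorem IsTrajectory.ae_hasDerivAt (h : IsTrajectory A σ a b u x) (hab : a ≤ b) :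
    ∀ᵐ r, r ∈ Ioo a b → HasDerivAt x (A *ᵥ x r + σ *ᵥ u r) r := by
  have : ∀ i, ∀ᵐ r, r ∈ Ioo a b → HasDerivAt (fun r => x r i) ((A *ᵥ x r + σ *ᵥ u r) i) r := by
    intro i
    filter_upwards [(h.intervalIntegrable hab i).ae_hasDerivAt_integral] with r hr hm
    have hm' : r ∈ uIcc a b := by rw [uIcc_of_le hab]; exact Ioo_subset_Icc_self hm
    refine ((hr hm' a left_mem_uIcc).const_add (x a i)).congr_of_eventuallyEq ?_
    filter_upwards [Ioo_mem_nhds hm.1 hm.2] with w hw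
    exact h.apply_eq hab i (Ioo_subset_Icc_self hw)
  filter_upwards [ae_all_iff.2 this] with r hr hm
  exact hasDerivAt_pi.2 fun i => hr i hm

theorem absolutelyContinuousOnInterval_dotProduct {v w : ℝ → Fin n → ℝ}
    (hv : ∀ i, AbsolutelyContinuousOnInterval (fun r => v r i) a b)
    (hw : ∀ i, AbsolutelyContinuousOnInterval (fun r => w r i) a b) :
    AbsolutelyContinuousOnInterval (fun r => v r ⬝ᵥ w r) a b :=
  absolutelyContinuousOnInterval_sum _ fun i _ => (hv i).mul (hw i)

theorem absolutelyContinuousOnInterval_mulVec {X : ℝ → Matrix (Fin n) (Fin m) ℝ}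
    {v : ℝ → Fin m → ℝ} (hX : ∀ i j, AbsolutelyContinuousOnInterval (fun r => X r i j) a b)
    (hv : ∀ i, AbsolutelyContinuousOnInterval (fun r => v r i) a b) (i : Fin n) :
    AbsolutelyContinuousOnInterval (fun r => (X r *ᵥ v r) i) a b :=
  absolutelyContinuousOnInterval_dotProduct (hX i) hv

theorem absolutelyContinuousOnInterval_matrix {X Y : ℝ → Matrix (Fin n) (Fin m) ℝ} (hab : a ≤ b)
    (hX : ∀ t ∈ Icc a b, HasDerivWithinAt X (Y t) (Icc a b) t) (hY : ContinuousOn Y (Icc a b))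
    (i : Fin n) (j : Fin m) : AbsolutelyContinuousOnInterval (fun r => X r i j) a b :=
  absolutelyContinuousOnInterval_of_hasDerivWithinAt hab
    (fun t ht => hasDerivWithinAt_matrix_iff.1 (hX t ht) i j)
    ((continuous_id.matrix_elem i j).comp_continuousOn hY)

/-- The result is kept as a derivative within `univ` so that the matrix product rules apply to it
directly. -/
theorem _root_.HasDerivWithinAt.hasDerivAt_of_mem_Ioo {X : ℝ → Matrix (Fin n) (Fin m) ℝ}
    {X' : Matrix (Fin n) (Fin m) ℝ} {t : ℝ} (hX : HasDerivWithinAt X X' (Icc a b) t)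
    (ht : t ∈ Ioo a b) : HasDerivWithinAt X X' univ t := by
  rw [hasDerivWithinAt_matrix_iff] at *
  exact fun i j => ((hX i j).hasDerivAt (Icc_mem_nhds ht.1 ht.2)).hasDerivWithinAt

end Trajectory

/-! ### Verification theorem for the linear-quadratic problem. -/

section Verification

variable {n m : ℕ} {A C : Matrix (Fin n) (Fin n) ℝ} {σ : Matrix (Fin n) (Fin m) ℝ} {a b : ℝ}
  {P S Q : ℝ → Matrix (Fin n) (Fin n) ℝ} {u : ℝ → Fin m → ℝ} {x : ℝ → Fin n → ℝ}

theorem dotProduct_mulVec_transpose {k l : ℕ} (M : Matrix (Fin k) (Fin l) ℝ) (v : Fin k → ℝ)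
    (w : Fin l → ℝ) : v ⬝ᵥ (M *ᵥ w) = (Mᵀ *ᵥ v) ⬝ᵥ w := by
  rw [Matrix.dotProduct_mulVec, Matrix.mulVec_transpose]

/-- Completion of the square behind the verification argument. -/
theorem completing_square {P : Matrix (Fin n) (Fin n) ℝ} (hP : Pᵀ = P)
    (S Q : Matrix (Fin n) (Fin n) ℝ) (x z : Fin n → ℝ) (u : Fin m → ℝ) :
    1 / 2 * ((A *ᵥ x + σ *ᵥ u) ⬝ᵥ (P *ᵥ x) +
        x ⬝ᵥ ((-(Aᵀ * P + P * A + C + P * (σ * σᵀ) * P)) *ᵥ x + P *ᵥ (A *ᵥ x + σ *ᵥ u))) +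
      ((A *ᵥ x + σ *ᵥ u) ⬝ᵥ (S *ᵥ z) +
        x ⬝ᵥ ((-((A + σ * σᵀ * P)ᵀ * S)) *ᵥ z + S *ᵥ 0)) +
      1 / 2 * (0 ⬝ᵥ (Q *ᵥ z) + z ⬝ᵥ ((-(Sᵀ * (σ * σᵀ) * S)) *ᵥ z + Q *ᵥ 0)) =
    -(1 / 2 * (x ⬝ᵥ (C *ᵥ x)) - 1 / 2 * (u ⬝ᵥ u)) -
      1 / 2 * ((u - σᵀ *ᵥ (P *ᵥ x + S *ᵥ z)) ⬝ᵥ (u - σᵀ *ᵥ (P *ᵥ x + S *ᵥ z))) := by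
  have e1 : ∀ v, x ⬝ᵥ (P *ᵥ v) = (P *ᵥ x) ⬝ᵥ v := fun v => by
    rw [dotProduct_mulVec_transpose, hP]
  have e2 : ∀ v, x ⬝ᵥ (Aᵀ *ᵥ v) = v ⬝ᵥ (A *ᵥ x) := fun v => by
    rw [dotProduct_mulVec_transpose, transpose_transpose, dotProduct_comm]
  have e3 : ∀ v, z ⬝ᵥ (Sᵀ *ᵥ v) = (S *ᵥ z) ⬝ᵥ v := fun v => by
    rw [dotProduct_mulVec_transpose, transpose_transpose]
  have e4 : ∀ v w, v ⬝ᵥ (σ *ᵥ w) = (σᵀ *ᵥ v) ⬝ᵥ w := dotProduct_mulVec_transpose σ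
  have e5 : ∀ v w, (σ *ᵥ w) ⬝ᵥ v = (σᵀ *ᵥ v) ⬝ᵥ w := fun v w => by rw [dotProduct_comm, e4]
  simp only [transpose_add, transpose_mul, transpose_transpose, hP, Matrix.neg_mulVec,
    Matrix.add_mulVec, Matrix.add_mul, ← Matrix.mulVec_mulVec, Matrix.mulVec_add, dotProduct_add,
    add_dotProduct, dotProduct_neg, sub_dotProduct, dotProduct_sub, Matrix.mulVec_zero,
    dotProduct_zero, zero_dotProduct, e1, e2, e3, e4, e5]
  rw [dotProduct_comm (A *ᵥ x) (P *ᵥ x), dotProduct_comm (A *ᵥ x) (S *ᵥ z),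
    dotProduct_comm u (σᵀ *ᵥ P *ᵥ x), dotProduct_comm u (σᵀ *ᵥ S *ᵥ z),
    dotProduct_comm (σᵀ *ᵥ P *ᵥ x) (σᵀ *ᵥ S *ᵥ z)]
  ring

theorem IsKernelFlow.absolutelyContinuous_biquad
    (h : IsKernelFlow A C (σ * σᵀ) a b P S Q) (hx : IsTrajectory A σ a b u x) (hab : a ≤ b)
    (z : Fin n → ℝ) :
    AbsolutelyContinuousOnInterval (fun r => biquad (P r) (S r) (Q r) (x r) z) a b := by
  have hPc := h.derivP.continuousOn
  have hSc := h.continuousOn_S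
  have hP := absolutelyContinuousOnInterval_matrix hab h.derivP (by fun_prop)
  have hS := absolutelyContinuousOnInterval_matrix hab h.derivS (by fun_prop)
  have hQ := absolutelyContinuousOnInterval_matrix hab h.derivQ (by fun_prop)
  have hX := hx.absolutelyContinuous hab
  have hz : ∀ i, AbsolutelyContinuousOnInterval (fun _ => z i) a b := fun i =>
    absolutelyContinuousOnInterval_const _
  exact (((absolutelyContinuousOnInterval_dotProduct hX
      (absolutelyContinuousOnInterval_mulVec hP hX)).const_mul (1 / 2)).add
    (absolutelyContinuousOnInterval_dotProduct hX
      (absolutelyContinuousOnInterval_mulVec hS hz))).add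
    ((absolutelyContinuousOnInterval_dotProduct hz
      (absolutelyContinuousOnInterval_mulVec hQ hz)).const_mul (1 / 2))

theorem IsKernelFlow.ae_hasDerivAt_biquad
    (h : IsKernelFlow A C (σ * σᵀ) a b P S Q) (hx : IsTrajectory A σ a b u x) (hab : a ≤ b)
    (z : Fin n → ℝ) :
    ∀ᵐ r, r ∈ Ioo a b → HasDerivAt (fun r => biquad (P r) (S r) (Q r) (x r) z)
      (-(1 / 2 * (x r ⬝ᵥ (C *ᵥ x r)) - 1 / 2 * (u r ⬝ᵥ u r)) -
        1 / 2 * ((u r - σᵀ *ᵥ (P r *ᵥ x r + S r *ᵥ z)) ⬝ᵥ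
          (u r - σᵀ *ᵥ (P r *ᵥ x r + S r *ᵥ z)))) r := by
  filter_upwards [hx.ae_hasDerivAt hab] with r hr hm
  have hI := Ioo_subset_Icc_self hm
  have dx := hasDerivWithinAt_univ.2 (hr hm)
  have dz := hasDerivWithinAt_const r univ z
  have dP := (h.derivP r hI).hasDerivAt_of_mem_Ioo hm
  have dS := (h.derivS r hI).hasDerivAt_of_mem_Ioo hm
  have dQ := (h.derivQ r hI).hasDerivAt_of_mem_Ioo hm
  have d := (((dx.dotProduct (dP.matrix_mulVec dx)).const_mul (1 / 2)).fun_add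
    (dx.dotProduct (dS.matrix_mulVec dz))).fun_add
      ((dz.dotProduct (dQ.matrix_mulVec dz)).const_mul (1 / 2))
  convert! hasDerivWithinAt_univ.1 d using 1
  have hP := h.symmP r hI
  -- The left side of `completing_square` is spelled as the product rule produces it, with the zero
  -- derivatives of the constant `z`.
  exact (completing_square hP (S r) (Q r) (x r) z (u r)).symm

/-- The payoff of a control falls short of the kernel by the squared distance to the feedback. -/
theorem IsKernelFlow.payoff_eq
    (h : IsKernelFlow A C (σ * σᵀ) a b P S Q) (hx : IsTrajectory A σ a b u x) (hab : a ≤ b)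
    (z : Fin n → ℝ) :
    (∫ r in a..b, (1 / 2 * (x r ⬝ᵥ (C *ᵥ x r)) - 1 / 2 * (u r ⬝ᵥ u r))) +
        biquad (P b) (S b) (Q b) (x b) z =
      biquad (P a) (S a) (Q a) (x a) z -
        ∫ r in a..b, 1 / 2 * ((u r - σᵀ *ᵥ (P r *ᵥ x r + S r *ᵥ z)) ⬝ᵥ
          (u r - σᵀ *ᵥ (P r *ᵥ x r + S r *ᵥ z))) := by
  obtain ⟨hi, he⟩ := integral_eq_sub_of_ae_hasDerivAt hab (h.absolutelyContinuous_biquad hx hab z)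
    (h.ae_hasDerivAt_biquad hx hab z)
  have hxc := hx.continuous
  have hr : IntervalIntegrable (fun r => 1 / 2 * (x r ⬝ᵥ (C *ᵥ x r)) - 1 / 2 * (u r ⬝ᵥ u r))
      volume a b := by
    refine IntervalIntegrable.sub ?_ ?_
    · exact ContinuousOn.intervalIntegrable_of_Icc hab (by fun_prop)
    · rw [intervalIntegrable_iff_integrable_Icc hab]
      refine Integrable.const_mul ?_ _
      exact integrable_finsetSum _ fun j _ => (hx.memLp_control j).integrable_mul
        (hx.memLp_control j)
  -- The completed square is minus the running payoff minus the derivative of the kernel, and each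
  -- of these is integrable on its own.
  have hk := intervalIntegral.integral_sub hr.neg hi
  simp only [Pi.neg_apply, intervalIntegral.integral_neg] at hk
  rw [he] at hk
  have e : (∫ r in a..b, 1 / 2 * ((u r - σᵀ *ᵥ (P r *ᵥ x r + S r *ᵥ z)) ⬝ᵥ
      (u r - σᵀ *ᵥ (P r *ᵥ x r + S r *ᵥ z)))) = _ :=
    (intervalIntegral.integral_congr fun r _ => by ring).trans hk
  rw [e]
  ring

/-- The optimal trajectory of the linear-quadratic problem with terminal payoff `φ_b(·, z)`. -/
theorem IsKernelFlow.exists_optimal (h : IsKernelFlow A C (σ * σᵀ) a b P S Q) (hab : a ≤ b)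
    (z y : Fin n → ℝ) :
    ∃ u x, IsTrajectory A σ a b u x ∧ x a = y ∧
      ∀ r, u r = σᵀ *ᵥ (P r *ᵥ x r + S r *ᵥ z) := by
  have ha : a ∈ Icc a b := ⟨le_rfl, hab⟩
  -- The gradient of the kernel in `z`, namely `S'x + Qz`, is constant along the closed loop.
  -- Solving for `x` gives the optimal path explicitly.
  set c : Fin n → ℝ := (S a)ᵀ *ᵥ y + Q a *ᵥ z with hc
  set x : ℝ → Fin n → ℝ := fun r => ((S r)⁻¹)ᵀ *ᵥ (c - Q r *ᵥ z) with hx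
  have hST : ∀ r ∈ Icc a b, ((S r)⁻¹)ᵀ * (S r)ᵀ = 1 := fun r hr => by
    rw [← transpose_mul, Matrix.mul_nonsing_inv _ ((Matrix.isUnit_iff_isUnit_det _).1
      (h.unitS r hr)), transpose_one]
  have dx : ∀ r ∈ Icc a b, HasDerivWithinAt x
      (A *ᵥ x r + σ *ᵥ (σᵀ *ᵥ (P r *ᵥ x r + S r *ᵥ z))) (Icc a b) r := by
    intro r hr
    have d := (h.hasDerivWithinAt_inv hr).matrix_transpose.matrix_mulVec
      ((hasDerivWithinAt_const r (Icc a b) c).fun_sub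
        ((h.derivQ r hr).matrix_mulVec (hasDerivWithinAt_const r (Icc a b) z)))
    convert! d using 1
    have e : ((S r)⁻¹)ᵀ *ᵥ ((S r)ᵀ *ᵥ (σ *ᵥ (σᵀ *ᵥ (S r *ᵥ z)))) =
        σ *ᵥ (σᵀ *ᵥ (S r *ᵥ z)) := by
      rw [Matrix.mulVec_mulVec, hST r hr, Matrix.one_mulVec]
    simp only [hx, transpose_mul, transpose_transpose, Matrix.neg_mulVec, Matrix.mulVec_zero,
      add_zero, zero_sub, neg_neg, ← Matrix.mulVec_mulVec, Matrix.add_mulVec,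
      Matrix.mulVec_add, e]
    abel
  have hxc : ContinuousOn x (Icc a b) := fun r hr => (dx r hr).continuousWithinAt
  have hPc := h.derivP.continuousOn
  have hSc := h.continuousOn_S
  have huc : ContinuousOn (fun r => σᵀ *ᵥ (P r *ᵥ x r + S r *ᵥ z)) (Icc a b) := by fun_prop
  refine ⟨fun r => σᵀ *ᵥ (P r *ᵥ x r + S r *ᵥ z), x, ⟨?_, hxc, fun r hr => ?_⟩, ?_, fun r => rfl⟩
  · obtain ⟨K, hK⟩ := isCompact_Icc.exists_bound_of_continuousOn huc
    exact MemLp.of_bound (huc.aestronglyMeasurable measurableSet_Icc) K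
      (ae_restrict_of_forall_mem measurableSet_Icc hK)
  · have hsub : Icc a r ⊆ Icc a b := Icc_subset_Icc_right hr.2
    rw [intervalIntegral.integral_eq_sub_of_hasDerivAt_of_le hr.1 (hxc.mono hsub)
      (fun w hw => (dx w (hsub (Ioo_subset_Icc_self hw))).hasDerivAt
        (Icc_mem_nhds hw.1 (hw.2.trans_le hr.2)))]
    · abel
    · refine ContinuousOn.intervalIntegrable_of_Icc hr.1 (ContinuousOn.mono ?_ hsub)
      fun_prop
  · simp only [hx, hc, add_sub_cancel_right]
    rw [Matrix.mulVec_mulVec, hST a ha, Matrix.one_mulVec]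

theorem IsKernelFlow.valueOp_eq (h : IsKernelFlow A C (σ * σᵀ) a b P S Q) (hab : a ≤ b)
    (z y : Fin n → ℝ) :
    valueOp A C σ a b (fun w => biquad (P b) (S b) (Q b) w z) y =
      (biquad (P a) (S a) (Q a) y z : EReal) := by
  refine le_antisymm (sSup_le ?_) (le_sSup ?_)
  · rintro v ⟨u, x, hx, rfl, rfl⟩
    rw [EReal.coe_le_coe_iff, h.payoff_eq hx hab z, sub_le_self_iff]
    refine intervalIntegral.integral_nonneg hab fun r _ => ?_
    exact mul_nonneg (by norm_num) (Finset.sum_nonneg fun i _ => mul_self_nonneg _)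
  · obtain ⟨u, x, hx, rfl, hu⟩ := h.exists_optimal hab z y
    refine ⟨u, x, hx, rfl, ?_⟩
    rw [EReal.coe_eq_coe_iff, h.payoff_eq hx hab z]
    simp [hu]

end Verification

/-! ### Positive definite forms, strict convexity and quadratic minimisation. -/

section Positive

variable {n m : ℕ} {D : Matrix (Fin n) (Fin n) ℝ}

/-- The quadratic form of `D` is positive definite; `D` itself need not be symmetric. -/
def IsPositive (D : Matrix (Fin n) (Fin n) ℝ) : Prop :=
  ∀ x : Fin n → ℝ, x ≠ 0 → 0 < x ⬝ᵥ (D *ᵥ x)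

theorem IsPositive.isUnit (hD : IsPositive D) : IsUnit D := by
  rw [← Matrix.mulVec_injective_iff_isUnit]
  refine (injective_iff_map_eq_zero D.mulVecLin).2 fun v hv => ?_
  by_contra h
  have := hD v h
  rw [show D *ᵥ v = 0 from hv, dotProduct_zero] at this
  exact this.false

theorem IsPositive.inv (hD : IsPositive D) : IsPositive D⁻¹ := by
  intro x hx
  have h : D *ᵥ (D⁻¹ *ᵥ x) = x := by
    rw [Matrix.mulVec_mulVec, Matrix.mul_nonsing_inv _ ((Matrix.isUnit_iff_isUnit_det _).1 hD.isUnit),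
      Matrix.one_mulVec]
  have h0 : D⁻¹ *ᵥ x ≠ 0 := fun h0 => hx (by rw [← h, h0, Matrix.mulVec_zero])
  have := hD _ h0
  rwa [h, dotProduct_comm] at this

theorem IsPositive.conj (hD : IsPositive D) {T : Matrix (Fin n) (Fin n) ℝ} (hT : IsUnit T) :
    IsPositive (T * D * Tᵀ) := by
  intro x hx
  rw [← Matrix.mulVec_mulVec, ← Matrix.mulVec_mulVec, dotProduct_mulVec_transpose]
  refine hD _ fun h => hx ?_
  have hT' : IsUnit Tᵀ := (Matrix.isUnit_transpose T).2 hT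
  exact Matrix.mulVec_injective_of_isUnit hT' (by rw [h, Matrix.mulVec_zero])

theorem IsPositive.add {D' : Matrix (Fin n) (Fin n) ℝ} (hD : IsPositive D) (hD' : IsPositive D') :
    IsPositive (D + D') := fun x hx => by
  rw [Matrix.add_mulVec, dotProduct_add]
  exact add_pos (hD x hx) (hD' x hx)

theorem biquad_sub (P S Q P' S' Q' : Matrix (Fin n) (Fin n) ℝ) (x z z' : Fin n → ℝ) :
    biquad P S Q x z - biquad P' S' Q' x z' = 1 / 2 * (x ⬝ᵥ ((P - P') *ᵥ x)) +
      x ⬝ᵥ (S *ᵥ z - S' *ᵥ z') + (1 / 2 * (z ⬝ᵥ (Q *ᵥ z)) - 1 / 2 * (z' ⬝ᵥ (Q' *ᵥ z'))) := by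
  simp only [biquad, Matrix.sub_mulVec, dotProduct_sub]
  ring

theorem isPositive_of_strictConvexOn {P S Q P' S' Q' : Matrix (Fin n) (Fin n) ℝ}
    (h : ∀ z, StrictConvexOn ℝ univ (fun x => biquad P S Q x z - biquad P' S' Q' x z)) :
    IsPositive (P - P') := by
  intro x hx
  have hne : x ≠ -x := fun h => hx (self_eq_neg.1 h)
  -- At `z = 0` the function is purely quadratic; strict convexity at the midpoint `0` of `x` and
  -- `-x` gives the sign.
  have := (h 0).2 (mem_univ x) (mem_univ (-x)) hne
    (show (0 : ℝ) < 1 / 2 by norm_num) (show (0 : ℝ) < 1 / 2 by norm_num) (by norm_num)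
  simp only [biquad_sub, smul_neg, add_neg_cancel, Matrix.mulVec_zero, dotProduct_zero, sub_zero,
    mul_zero, add_zero, Matrix.mulVec_neg, dotProduct_neg, neg_dotProduct, neg_neg,
    smul_eq_mul] at this
  linarith

theorem IsPositive.strictConvexOn {P S Q P' S' Q' : Matrix (Fin n) (Fin n) ℝ}
    (h : IsPositive (P - P')) (z : Fin n → ℝ) :
    StrictConvexOn ℝ univ (fun x => biquad P S Q x z - biquad P' S' Q' x z) := by
  refine ⟨convex_univ, fun x _ y _ hxy a b ha hb hab => ?_⟩
  -- This product is twice the convexity defect `a f(x) + b f(y) - f(ax + by)`.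
  have hpos := mul_pos (mul_pos ha hb) (h (x - y) (sub_ne_zero.2 hxy))
  obtain rfl : b = 1 - a := by linarith
  simp only [biquad_sub, Matrix.mulVec_add, Matrix.mulVec_sub, Matrix.mulVec_smul, dotProduct_add,
    add_dotProduct, dotProduct_sub, sub_dotProduct, dotProduct_smul, smul_dotProduct,
    smul_eq_mul] at hpos ⊢
  nlinarith

/-- The infimum of a positive definite quadratic function, at its stationary point. -/
theorem IsPositive.iInf_quadratic (hD : IsPositive D) (hs : Dᵀ = D) {β x₀ : Fin n → ℝ}
    (h₀ : D *ᵥ x₀ = -β) (κ : ℝ) :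
    ⨅ x : Fin n → ℝ, ((1 / 2 * (x ⬝ᵥ (D *ᵥ x)) + x ⬝ᵥ β + κ : ℝ) : EReal) =
      ((κ + 1 / 2 * (x₀ ⬝ᵥ β) : ℝ) : EReal) := by
  have hβ : β = -(D *ᵥ x₀) := by rw [h₀, neg_neg]
  refine le_antisymm (iInf_le_of_le x₀ ?_) (le_iInf fun x => ?_)
  · rw [EReal.coe_le_coe_iff, h₀, dotProduct_neg]
    linarith
  · rw [EReal.coe_le_coe_iff]
    have hnn : 0 ≤ (x - x₀) ⬝ᵥ (D *ᵥ (x - x₀)) := by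
      rcases eq_or_ne (x - x₀) 0 with h | h
      · simp [h]
      · exact (hD _ h).le
    have hsym : x₀ ⬝ᵥ (D *ᵥ x) = x ⬝ᵥ (D *ᵥ x₀) := by
      rw [dotProduct_mulVec_transpose, hs, dotProduct_comm]
    simp only [Matrix.mulVec_sub, dotProduct_sub, sub_dotProduct] at hnn
    rw [hβ, dotProduct_neg, dotProduct_neg]
    linarith

end Positive

/-! ### Monotonicity in time and the controllability Gramian. -/

section Monotone

variable {n m : ℕ} {A C : Matrix (Fin n) (Fin n) ℝ} {σ : Matrix (Fin n) (Fin m) ℝ} {a b : ℝ}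
  {P S Q p s q : ℝ → Matrix (Fin n) (Fin n) ℝ}

theorem antitoneOn_of_hasDerivWithinAt_Icc {f f' : ℝ → ℝ}
    (hf : ∀ t ∈ Icc a b, HasDerivWithinAt f (f' t) (Icc a b) t) (h : ∀ t ∈ Icc a b, f' t ≤ 0) :
    AntitoneOn f (Icc a b) :=
  antitoneOn_of_hasDerivWithinAt_nonpos (convex_Icc a b) (fun t ht => (hf t ht).continuousWithinAt)
    (fun t ht => (hf t (interior_subset ht)).mono interior_subset)
    (fun t ht => h t (interior_subset ht))

theorem hasDerivWithinAt_quadratic {X : ℝ → Matrix (Fin n) (Fin n) ℝ}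
    {X' : Matrix (Fin n) (Fin n) ℝ} {s : Set ℝ} {t : ℝ} (hX : HasDerivWithinAt X X' s t)
    (v : Fin n → ℝ) : HasDerivWithinAt (fun r => v ⬝ᵥ (X r *ᵥ v)) (v ⬝ᵥ (X' *ᵥ v)) s t := by
  have d := (hasDerivWithinAt_const t s v).dotProduct
    (hX.matrix_mulVec (hasDerivWithinAt_const t s v))
  simpa using d

/-- The derivative of `M⁻¹` is `-M⁻¹S'σσ'S M⁻¹ ≤ 0`, so `M⁻¹` can only grow backward from its
positive value at `b`; then `p - P = S M⁻¹ S'` is a congruence. -/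
theorem IsKernelFlow.isPositive_sub (h : IsKernelFlow A C (σ * σᵀ) a b P S Q)
    (hp : IsRiccatiOn A C (σ * σᵀ) a b p) (hpb : (p b)ᵀ = p b) (hu : IsPositive (p b - P b)) :
    ∀ t ∈ Icc a b, IsPositive (p t - P t) := by
  intro t ht
  have hb : b ∈ Icc a b := ⟨ht.1.trans ht.2, le_rfl⟩
  have hb0 : IsPositive (diffMat P S Q p b b)⁻¹ := by
    have := (hu.inv.conj ((Matrix.isUnit_transpose _).2 (h.unitS b hb))).inv
    simpa [diffMat] using this
  have ht0 : IsPositive (diffMat P S Q p b t)⁻¹ := by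
    intro v hv
    refine (hb0 v hv).trans_le (antitoneOn_of_hasDerivWithinAt_Icc
      (fun r hr => hasDerivWithinAt_quadratic
        (h.hasDerivWithinAt_inv_diffMat hp hu.isUnit hr) v) (fun r hr => ?_) ht hb ht.2)
    have e : ((diffMat P S Q p b r)⁻¹)ᵀ = (diffMat P S Q p b r)⁻¹ := by
      rw [transpose_nonsing_inv, h.transpose_diffMat hpb hr]
    rw [Matrix.neg_mulVec, dotProduct_neg, neg_nonpos]
    simp only [← Matrix.mulVec_mulVec]
    rw [dotProduct_mulVec_transpose, e, dotProduct_mulVec_transpose, transpose_transpose,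
      dotProduct_mulVec_transpose]
    exact Finset.sum_nonneg fun i _ => mul_self_nonneg _
  rw [h.riccati_eq hp hu.isUnit t ht, add_sub_cancel_left]
  exact ht0.conj (h.unitS t ht)

/-- `Q a - Q b` is the Gramian `∫ S'σσ'S`. If it fails to be positive on `v`, then `σ'S_r v = 0`
throughout, and `S_r v` is an adjoint direction that no control can influence. -/
theorem IsKernelFlow.isPositive_Q_sub (h : IsKernelFlow A C (σ * σᵀ) a b P S Q) (hab : a < b)
    (hctrl : ControllableOn A σ a b) : IsPositive (Q a - Q b) := by
  intro v hv
  have ha : a ∈ Icc a b := ⟨le_rfl, hab.le⟩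
  have hb : b ∈ Icc a b := ⟨hab.le, le_rfl⟩
  have e : ∀ r, v ⬝ᵥ ((-((S r)ᵀ * (σ * σᵀ) * S r)) *ᵥ v) =
      -((σᵀ *ᵥ (S r *ᵥ v)) ⬝ᵥ (σᵀ *ᵥ (S r *ᵥ v))) := by
    intro r
    rw [Matrix.neg_mulVec, dotProduct_neg]
    simp only [← Matrix.mulVec_mulVec]
    rw [dotProduct_mulVec_transpose, transpose_transpose, dotProduct_mulVec_transpose]
  have dg := fun r hr => hasDerivWithinAt_quadratic (h.derivQ r hr) v
  have hg := antitoneOn_of_hasDerivWithinAt_Icc dg fun r _ => by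
    rw [e, neg_nonpos]
    exact Finset.sum_nonneg fun i _ => mul_self_nonneg _
  rw [Matrix.sub_mulVec, dotProduct_sub, sub_pos]
  by_contra! hle
  have hconst : EqOn (fun r => v ⬝ᵥ (Q r *ᵥ v)) (fun _ => v ⬝ᵥ (Q b *ᵥ v)) (Icc a b) :=
    fun r hr => le_antisymm ((hg ha hr hr.1).trans hle) (hg hr hb hr.2)
  have hzero : ∀ r ∈ Icc a b, σᵀ *ᵥ (S r *ᵥ v) = 0 := by
    intro r hr
    have d0 := (hasDerivWithinAt_const r (Icc a b) (v ⬝ᵥ (Q b *ᵥ v))).congr hconst (hconst hr)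
    have := (uniqueDiffOn_Icc hab r hr).eq_deriv _ (dg r hr) d0
    rw [e, neg_eq_zero] at this
    exact dotProduct_self_eq_zero.1 this
  -- The pairing `(S_r v)·x_r` is constant on trajectories; steering from `0` to `S_b v` forces
  -- `|S_b v|² = 0`.
  obtain ⟨u, x, hx, hxa, hxb⟩ := hctrl 0 (S b *ᵥ v)
  have hSc := h.continuousOn_S
  have hPc := h.derivP.continuousOn
  have hS := absolutelyContinuousOnInterval_matrix hab.le h.derivS (by fun_prop)
  have hac : AbsolutelyContinuousOnInterval (fun r => (S r *ᵥ v) ⬝ᵥ x r) a b :=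
    absolutelyContinuousOnInterval_dotProduct (absolutelyContinuousOnInterval_mulVec hS
      fun i => absolutelyContinuousOnInterval_const (v i)) (hx.absolutelyContinuous hab.le)
  have hd : ∀ᵐ r, r ∈ Ioo a b → HasDerivAt (fun r => (S r *ᵥ v) ⬝ᵥ x r) 0 r := by
    filter_upwards [hx.ae_hasDerivAt hab.le] with r hr hm
    have hI := Ioo_subset_Icc_self hm
    have d := (((h.derivS r hI).hasDerivAt_of_mem_Ioo hm).matrix_mulVec
      (hasDerivWithinAt_const r univ v)).dotProduct (hasDerivWithinAt_univ.2 (hr hm))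
    convert! hasDerivWithinAt_univ.1 d using 1
    have e1 : ∀ w, (S r *ᵥ v) ⬝ᵥ (σ *ᵥ w) = 0 := fun w => by
      rw [dotProduct_mulVec_transpose, hzero r hI, zero_dotProduct]
    have e2 : ∀ w, (S r *ᵥ v) ⬝ᵥ (A *ᵥ w) = (Aᵀ *ᵥ (S r *ᵥ v)) ⬝ᵥ w :=
      dotProduct_mulVec_transpose A _
    simp only [transpose_add, transpose_mul, transpose_transpose, Matrix.neg_mulVec,
      Matrix.add_mulVec, ← Matrix.mulVec_mulVec, hzero r hI, Matrix.mulVec_zero, add_zero,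
      dotProduct_add, e1, e2, neg_dotProduct]
    ring
  have := (integral_eq_sub_of_ae_hasDerivAt hab.le hac hd).2
  rw [hxa, hxb, dotProduct_zero, sub_zero, intervalIntegral.integral_zero] at this
  have h1 : S b *ᵥ v = 0 := dotProduct_self_eq_zero.1 this.symm
  exact hv (Matrix.mulVec_injective_of_isUnit (h.unitS b hb) (by rw [h1, Matrix.mulVec_zero]))

end Monotone

/-! ### Propagation formulas and conservation of the dual. -/

section Doubling

variable {n m : ℕ} {A C : Matrix (Fin n) (Fin n) ℝ} {σ : Matrix (Fin n) (Fin m) ℝ} {a b : ℝ}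
  {P S Q p s q : ℝ → Matrix (Fin n) (Fin n) ℝ}

/-- Put `N = T'D⁻¹T`, so `M = N - G`. Then `(-D + TG⁻¹T')D⁻¹T = TG⁻¹M` and `M(M⁻¹ - N⁻¹) = GN⁻¹`,
and what remains is `T N⁻¹ T' D⁻¹ = 1`. With `G = Q a - Q b` this converts `pure_eq` into the
symmetric formula and gives invertibility of its bracket. -/
theorem mul_woodbury {D T G M : Matrix (Fin n) (Fin n) ℝ} (hD : IsUnit D) (hT : IsUnit T)
    (hG : IsUnit G) (hM : IsUnit M) (h : M = Tᵀ * D⁻¹ * T - G) :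
    (-D + T * G⁻¹ * Tᵀ) * (D⁻¹ * T * (M⁻¹ - (Tᵀ * D⁻¹ * T)⁻¹) * Tᵀ * D⁻¹) = 1 := by
  have hD' := (Matrix.isUnit_iff_isUnit_det _).1 hD
  have hT' := (Matrix.isUnit_iff_isUnit_det _).1 hT
  have hTT : IsUnit Tᵀ.det := by rwa [Matrix.det_transpose]
  have hG' := (Matrix.isUnit_iff_isUnit_det _).1 hG
  have hM' := (Matrix.isUnit_iff_isUnit_det _).1 hM
  have hM₀ : IsUnit (Tᵀ * D⁻¹ * T).det := by
    rw [Matrix.det_mul, Matrix.det_mul]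
    exact (hTT.mul (Matrix.isUnit_nonsing_inv_det _ hD')).mul hT'
  have e1 : (-D + T * G⁻¹ * Tᵀ) * (D⁻¹ * T) = T * G⁻¹ * M := by
    rw [h, Matrix.add_mul, Matrix.mul_sub, Matrix.neg_mul,
      Matrix.mul_nonsing_inv_cancel_left _ _ hD', Matrix.nonsing_inv_mul_cancel_right _ _ hG']
    simp only [Matrix.mul_assoc]
    abel
  have e2 : M * (M⁻¹ - (Tᵀ * D⁻¹ * T)⁻¹) = G * (Tᵀ * D⁻¹ * T)⁻¹ := by
    rw [Matrix.mul_sub, Matrix.mul_nonsing_inv _ hM']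
    nth_rewrite 1 [h]
    rw [Matrix.sub_mul, Matrix.mul_nonsing_inv _ hM₀]
    abel
  have e3 : (Tᵀ * D⁻¹ * T)⁻¹ = T⁻¹ * (D * (Tᵀ)⁻¹) := by
    rw [Matrix.mul_inv_rev, Matrix.mul_inv_rev, Matrix.nonsing_inv_nonsing_inv _ hD']
  calc (-D + T * G⁻¹ * Tᵀ) * (D⁻¹ * T * (M⁻¹ - (Tᵀ * D⁻¹ * T)⁻¹) * Tᵀ * D⁻¹)
      = ((-D + T * G⁻¹ * Tᵀ) * (D⁻¹ * T)) * (M⁻¹ - (Tᵀ * D⁻¹ * T)⁻¹) * Tᵀ * D⁻¹ := by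
        simp only [Matrix.mul_assoc]
    _ = T * (G⁻¹ * (M * (M⁻¹ - (Tᵀ * D⁻¹ * T)⁻¹))) * Tᵀ * D⁻¹ := by
        rw [e1]; simp only [Matrix.mul_assoc]
    _ = 1 := by
        rw [e2, Matrix.nonsing_inv_mul_cancel_left _ _ hG', e3,
          Matrix.mul_nonsing_inv_cancel_left _ _ hT', Matrix.nonsing_inv_mul_cancel_right _ _ hTT,
          Matrix.mul_nonsing_inv _ hD']

/-- The propagation formulas for a second kernel, in terms of the first. -/
theorem IsKernelFlow.propagation (h : IsKernelFlow A C (σ * σᵀ) a b P S Q)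
    (h' : IsKernelFlow A C (σ * σᵀ) a b p s q) (hab : a < b) (hctrl : ControllableOn A σ a b)
    (hu : IsPositive (p b - P b)) :
    IsUnit (Q a - Q b) ∧
    IsUnit ((Q b - Q a) + (S b)ᵀ * (p b - P b)⁻¹ * S b) ∧
    IsUnit ((P b - p b) + S b * (Q a - Q b)⁻¹ * (S b)ᵀ) ∧
    p a = P a + S a * ((Q b - Q a) + (S b)ᵀ * (p b - P b)⁻¹ * S b)⁻¹ * (S a)ᵀ ∧
    s a = S a * ((Q b - Q a) + (S b)ᵀ * (p b - P b)⁻¹ * S b)⁻¹ * (S b)ᵀ * (p b - P b)⁻¹ * s b ∧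
    q a = q b + (s b)ᵀ * ((P b - p b) + S b * (Q a - Q b)⁻¹ * (S b)ᵀ)⁻¹ * s b := by
  have ha : a ∈ Icc a b := ⟨le_rfl, hab.le⟩
  have hb : b ∈ Icc a b := ⟨hab.le, le_rfl⟩
  have hM : (Q b - Q a) + (S b)ᵀ * (p b - P b)⁻¹ * S b = diffMat P S Q p b a := by
    rw [diffMat]; abel
  have hQ := (h.isPositive_Q_sub hab hctrl).isUnit
  have hMu := h.isUnit_diffMat h'.derivP hu.isUnit a ha
  have hw := mul_woodbury hu.isUnit (h.unitS b hb) hQ hMu (by rw [diffMat]; abel)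
  rw [neg_sub] at hw
  rw [hM]
  refine ⟨hQ, hMu, IsUnit.of_mul_eq_one _ hw, h.riccati_eq h'.derivP hu.isUnit a ha, ?_, ?_⟩
  · rw [h.mixed_eq h' hu.isUnit a ha]
    simp only [Matrix.mul_assoc]
  · rw [Matrix.inv_eq_right_inv hw]
    have e : ((p b - P b)⁻¹)ᵀ = (p b - P b)⁻¹ := by
      rw [transpose_nonsing_inv, transpose_sub, h'.symmP b hb, h.symmP b hb]
    have e0 : diffMat P S Q p b b = (S b)ᵀ * (p b - P b)⁻¹ * S b := by simp [diffMat]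
    rw [h.pure_eq h' hu.isUnit a ha, e0]
    simp only [transpose_mul, transpose_transpose, e, Matrix.mul_assoc]

/-- The semiconvex dual of one kernel under another is conserved. -/
theorem IsKernelFlow.semiconvexDual_eq (h : IsKernelFlow A C (σ * σᵀ) a b P S Q)
    (h' : IsKernelFlow A C (σ * σᵀ) a b p s q) (hab : a ≤ b)
    (hu : IsPositive (p b - P b)) (z z' : Fin n → ℝ) :
    ∃ r : ℝ,
      semiconvexDual (biquad (P b) (S b) (Q b)) (fun x => biquad (p b) (s b) (q b) x z') z =
        (r : EReal) ∧
      semiconvexDual (biquad (P a) (S a) (Q a)) (fun x => biquad (p a) (s a) (q a) x z') z =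
        (r : EReal) := by
  have ha : a ∈ Icc a b := ⟨le_rfl, hab⟩
  have hb : b ∈ Icc a b := ⟨hab, le_rfl⟩
  have hsym : ∀ t ∈ Icc a b, (p t - P t)ᵀ = p t - P t := fun t ht => by
    rw [transpose_sub, h'.symmP t ht, h.symmP t ht]
  have hD := (Matrix.isUnit_iff_isUnit_det _).1 hu.isUnit
  have hDi : ((p b - P b)⁻¹)ᵀ = (p b - P b)⁻¹ := by
    rw [transpose_nonsing_inv, hsym b hb]
  have hSa := (Matrix.isUnit_iff_isUnit_det _).1 (h.unitS a ha)
  have hSaT : IsUnit (S a)ᵀ.det := by rwa [Matrix.det_transpose]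
  have hMa := (Matrix.isUnit_iff_isUnit_det _).1 (h.isUnit_diffMat h'.derivP hu.isUnit a ha)
  have hMs := h.transpose_diffMat (h'.symmP b hb) ha
  have hpos := h.isPositive_sub h'.derivP (h'.symmP b hb) hu a ha
  have hp := h.riccati_eq h'.derivP hu.isUnit a ha
  have hs := h.mixed_eq h' hu.isUnit a ha
  have hq := h.pure_eq h' hu.isUnit a ha
  have e0 : diffMat P S Q p b b = (S b)ᵀ * (p b - P b)⁻¹ * S b := by simp [diffMat]
  -- With this, `pure_eq` reads `q a = q b + K'M⁻¹K - s_b'(p_b - P_b)⁻¹s_b`.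
  have hKK : ((S b)ᵀ * (p b - P b)⁻¹ * s b)ᵀ * (diffMat P S Q p b b)⁻¹ *
      ((S b)ᵀ * (p b - P b)⁻¹ * s b) = (s b)ᵀ * (p b - P b)⁻¹ * s b := by
    have hSb := (Matrix.isUnit_iff_isUnit_det _).1 (h.unitS b hb)
    have hSbT : IsUnit (S b)ᵀ.det := by rwa [Matrix.det_transpose]
    rw [e0, Matrix.mul_inv_rev, Matrix.mul_inv_rev, Matrix.nonsing_inv_nonsing_inv _ hD]
    simp only [transpose_mul, transpose_transpose, hDi, Matrix.mul_assoc]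
    rw [Matrix.nonsing_inv_mul_cancel_left _ _ hSbT, Matrix.mul_nonsing_inv_cancel_left _ _ hD,
      Matrix.mul_nonsing_inv_cancel_left _ _ hSb]
  set K := (S b)ᵀ * (p b - P b)⁻¹ * s b with hK
  set M := diffMat P S Q p b a with hM
  -- The conserved quantity; together with `hKK` it equates the two minimal values.
  have hMQ : M + Q a = (S b)ᵀ * (p b - P b)⁻¹ * S b + Q b := by rw [hM, diffMat]; abel
  clear_value K M
  have hMis : (M⁻¹)ᵀ = M⁻¹ := by rw [transpose_nonsing_inv, hMs]
  refine ⟨1 / 2 * (z' ⬝ᵥ (q b *ᵥ z')) - 1 / 2 * (z ⬝ᵥ (Q b *ᵥ z)) +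
    1 / 2 * (-((p b - P b)⁻¹ *ᵥ (s b *ᵥ z' - S b *ᵥ z)) ⬝ᵥ (s b *ᵥ z' - S b *ᵥ z)), ?_, ?_⟩
  · simp only [semiconvexDual, biquad_sub]
    refine hu.iInf_quadratic (hsym b hb) (x₀ := -((p b - P b)⁻¹ *ᵥ (s b *ᵥ z' - S b *ᵥ z))) ?_ _
    rw [Matrix.mulVec_neg, Matrix.mulVec_mulVec, Matrix.mul_nonsing_inv _ hD, Matrix.one_mulVec]
  · simp only [semiconvexDual, biquad_sub]
    -- Since `p a - P a = S M⁻¹ S'` and `s a = S M⁻¹ K`, stationarity at `a` reduces to `S'x = Mz -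
    -- Kz'`.
    rw [hpos.iInf_quadratic (hsym a ha) (x₀ := ((S a)ᵀ)⁻¹ *ᵥ (M *ᵥ z - K *ᵥ z')) ?_ _]
    · rw [EReal.coe_eq_coe_iff]
      have hz := congrArg (fun X : Matrix (Fin n) (Fin n) ℝ => z ⬝ᵥ (X *ᵥ z)) hMQ
      have hz' := congrArg (fun X : Matrix (Fin n) (Fin n) ℝ => z' ⬝ᵥ (X *ᵥ z')) hKK
      have hx : (((S a)ᵀ)⁻¹ *ᵥ (M *ᵥ z - K *ᵥ z')) ⬝ᵥ (s a *ᵥ z' - S a *ᵥ z) =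
          (M *ᵥ z - K *ᵥ z') ⬝ᵥ (M⁻¹ *ᵥ (K *ᵥ z') - z) := by
        rw [hs, ← Matrix.mulVec_mulVec, ← Matrix.mulVec_mulVec, ← Matrix.mulVec_sub,
          dotProduct_mulVec_transpose, Matrix.mulVec_mulVec, Matrix.mul_nonsing_inv _ hSaT,
          Matrix.one_mulVec]
      have hzM : (M *ᵥ z) ⬝ᵥ (M⁻¹ *ᵥ (K *ᵥ z')) = z ⬝ᵥ (K *ᵥ z') := by
        rw [dotProduct_mulVec_transpose, hMis, Matrix.mulVec_mulVec, Matrix.nonsing_inv_mul _ hMa,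
          Matrix.one_mulVec]
      have hKz : z ⬝ᵥ (K *ᵥ z') = (S b *ᵥ z) ⬝ᵥ ((p b - P b)⁻¹ *ᵥ (s b *ᵥ z')) := by
        rw [hK, ← Matrix.mulVec_mulVec, ← Matrix.mulVec_mulVec, dotProduct_mulVec_transpose,
          transpose_transpose]
      have hsw : ((p b - P b)⁻¹ *ᵥ (s b *ᵥ z' - S b *ᵥ z)) ⬝ᵥ (s b *ᵥ z' - S b *ᵥ z) =
          (s b *ᵥ z') ⬝ᵥ ((p b - P b)⁻¹ *ᵥ (s b *ᵥ z')) -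
            2 * ((S b *ᵥ z) ⬝ᵥ ((p b - P b)⁻¹ *ᵥ (s b *ᵥ z'))) +
            (S b *ᵥ z) ⬝ᵥ ((p b - P b)⁻¹ *ᵥ (S b *ᵥ z)) := by
        have : (s b *ᵥ z') ⬝ᵥ ((p b - P b)⁻¹ *ᵥ (S b *ᵥ z)) =
            (S b *ᵥ z) ⬝ᵥ ((p b - P b)⁻¹ *ᵥ (s b *ᵥ z')) := by
          rw [dotProduct_mulVec_transpose, hDi, dotProduct_comm]
        rw [dotProduct_comm]
        simp only [Matrix.mulVec_sub, dotProduct_sub, sub_dotProduct, this]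
        ring
      have hT : ∀ (T X : Matrix (Fin n) (Fin n) ℝ) (v : Fin n → ℝ),
          v ⬝ᵥ ((Tᵀ * X * T) *ᵥ v) = (T *ᵥ v) ⬝ᵥ (X *ᵥ (T *ᵥ v)) := fun T X v => by
        rw [← Matrix.mulVec_mulVec, ← Matrix.mulVec_mulVec, dotProduct_mulVec_transpose,
          transpose_transpose]
      rw [hx, hq, neg_dotProduct, hsw, ← hKz]
      simp only [Matrix.add_mulVec, dotProduct_add, dotProduct_sub, sub_dotProduct, hT, hzM,
        Matrix.sub_mulVec] at hz hz' ⊢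
      rw [dotProduct_comm (K *ᵥ z') z, dotProduct_comm (M *ᵥ z) z]
      linarith
    · rw [hp, add_sub_cancel_left, Matrix.mulVec_mulVec,
        Matrix.mul_nonsing_inv_cancel_right _ _ hSaT, hs, Matrix.mulVec_sub, Matrix.mulVec_mulVec,
        Matrix.mulVec_mulVec, Matrix.nonsing_inv_mul_cancel_right _ _ hMa, neg_sub]

end Doubling

end RiccatiDoubling

/-! ### Assembly of the three claims. -/

theorem mainTheorem10 {n m : ℕ} (A C : Matrix (Fin n) (Fin n) ℝ) (σ : Matrix (Fin n) (Fin m) ℝ)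
    (hC : C.IsSymm) (τ : ℝ)
    (hctrl : ∀ s t, τ ≤ s → s < t → t ≤ 0 → ControllableOn A σ s t)
    (P S Q : ℝ → Matrix (Fin n) (Fin n) ℝ)
    (hP₀ : (P 0).IsSymm) (hQ₀ : (Q 0).IsSymm) (hS₀ : IsUnit (S 0))
    (hsol : SolvesBiRiccati A C σ τ P S Q) :
    -- the two-time formulas
    (∀ t₁ t₂ : ℝ, t₁ < 0 → t₂ < 0 → τ ≤ t₁ + t₂ →
      (∀ z, StrictConvexOn ℝ univ
        (fun x => biquad (P t₂) (S t₂) (Q t₂) x z - biquad (P 0) (S 0) (Q 0) x z)) →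
      (∀ x z,
        valueOp A C σ t₁ 0 (fun y => biquad (P t₂) (S t₂) (Q t₂) y z) x =
            (biquad (P (t₁ + t₂)) (S (t₁ + t₂)) (Q (t₁ + t₂)) x z : EReal) ∧
        valueOp A C σ t₂ 0 (fun y => biquad (P t₁) (S t₁) (Q t₁) y z) x =
            (biquad (P (t₁ + t₂)) (S (t₁ + t₂)) (Q (t₁ + t₂)) x z : EReal) ∧
        valueOp A C σ (t₁ + t₂) t₂ (fun y => biquad (P t₂) (S t₂) (Q t₂) y z) x =
            (biquad (P (t₁ + t₂)) (S (t₁ + t₂)) (Q (t₁ + t₂)) x z : EReal)) ∧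
      (∀ z z' : Fin n → ℝ, ∃ r : ℝ,
        semiconvexDual (biquad (P 0) (S 0) (Q 0))
            (fun x => biquad (P t₂) (S t₂) (Q t₂) x z') z = (r : EReal) ∧
        semiconvexDual (biquad (P t₁) (S t₁) (Q t₁))
            (fun y => biquad (P (t₁ + t₂)) (S (t₁ + t₂)) (Q (t₁ + t₂)) y z') z = (r : EReal)) ∧
      IsUnit (P t₂ - P 0) ∧ IsUnit (Q t₁ - Q 0) ∧
      IsUnit ((Q 0 - Q t₁) + (S 0)ᵀ * (P t₂ - P 0)⁻¹ * S 0) ∧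
      IsUnit ((P 0 - P t₂) + S 0 * (Q t₁ - Q 0)⁻¹ * (S 0)ᵀ) ∧
      P (t₁ + t₂) = P t₁ +
        S t₁ * ((Q 0 - Q t₁) + (S 0)ᵀ * (P t₂ - P 0)⁻¹ * S 0)⁻¹ * (S t₁)ᵀ ∧
      S (t₁ + t₂) =
        S t₁ * ((Q 0 - Q t₁) + (S 0)ᵀ * (P t₂ - P 0)⁻¹ * S 0)⁻¹ * (S 0)ᵀ *
          (P t₂ - P 0)⁻¹ * S t₂ ∧
      Q (t₁ + t₂) = Q t₂ +
        (S t₂)ᵀ * ((P 0 - P t₂) + S 0 * (Q t₁ - Q 0)⁻¹ * (S 0)ᵀ)⁻¹ * S t₂) ∧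
    -- kernel doubling, once and repeatedly
    (∀ Δ : ℝ, 0 ≤ Δ →
      (∀ z, StrictConvexOn ℝ univ
        (fun x => biquad (P (-Δ)) (S (-Δ)) (Q (-Δ)) x z - biquad (P 0) (S 0) (Q 0) x z)) →
      (τ ≤ -(2 * Δ) →
        IsUnit (P (-Δ) - P 0) ∧ IsUnit (Q (-Δ) - Q 0) ∧
        IsUnit ((Q 0 - Q (-Δ)) + (S 0)ᵀ * (P (-Δ) - P 0)⁻¹ * S 0) ∧
        IsUnit ((P 0 - P (-Δ)) + S 0 * (Q (-Δ) - Q 0)⁻¹ * (S 0)ᵀ) ∧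
        P (-(2 * Δ)) = P (-Δ) +
          S (-Δ) * ((Q 0 - Q (-Δ)) + (S 0)ᵀ * (P (-Δ) - P 0)⁻¹ * S 0)⁻¹ * (S (-Δ))ᵀ ∧
        S (-(2 * Δ)) =
          S (-Δ) * ((Q 0 - Q (-Δ)) + (S 0)ᵀ * (P (-Δ) - P 0)⁻¹ * S 0)⁻¹ * (S 0)ᵀ *
            (P (-Δ) - P 0)⁻¹ * S (-Δ) ∧
        Q (-(2 * Δ)) = Q (-Δ) +
          (S (-Δ))ᵀ * ((P 0 - P (-Δ)) + S 0 * (Q (-Δ) - Q 0)⁻¹ * (S 0)ᵀ)⁻¹ * S (-Δ)) ∧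
      (∀ N : ℕ, τ ≤ -(2 ^ N * Δ) →
        (∀ z, StrictConvexOn ℝ univ
          (fun x => biquad (P (-(2 ^ N * Δ))) (S (-(2 ^ N * Δ))) (Q (-(2 ^ N * Δ))) x z -
            biquad (P 0) (S 0) (Q 0) x z)) ∧
        (P (-(2 ^ N * Δ)), S (-(2 ^ N * Δ)), Q (-(2 ^ N * Δ))) =
          (doublingStep (P 0) (S 0) (Q 0))^[N] (P (-Δ), S (-Δ), Q (-Δ)))) ∧
    -- propagation of an arbitrary solution of the Riccati equation
    (∀ (t : ℝ) (p : ℝ → Matrix (Fin n) (Fin n) ℝ), τ ≤ t → t ≤ 0 →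
      (p 0).IsSymm → SolvesRiccati A C σ t p → IsUnit (p 0 - P 0) →
      IsUnit (Q t - Q 0 - (S 0)ᵀ * (p 0 - P 0)⁻¹ * S 0) ∧
      p t = P t - S t * (Q t - Q 0 - (S 0)ᵀ * (p 0 - P 0)⁻¹ * S 0)⁻¹ * (S t)ᵀ) := by
  have flow : τ ≤ 0 → IsKernelFlow A C (σ * σᵀ) τ 0 P S Q := fun h0 =>
    .of_terminal h0 hC (by rw [transpose_mul, transpose_transpose])
      (fun t ht => hasDerivWithinAt_matrix_iff.2 (hsol.eqP t ht))
      (fun t ht => hasDerivWithinAt_matrix_iff.2 (hsol.eqS t ht))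
      (fun t ht => hasDerivWithinAt_matrix_iff.2 (hsol.eqQ t ht)) hP₀ hQ₀ hS₀
  have two_time : ∀ t₁ t₂ : ℝ, t₁ < 0 → t₂ < 0 → τ ≤ t₁ + t₂ → IsPositive (P t₂ - P 0) →
      IsUnit (P t₂ - P 0) ∧ IsUnit (Q t₁ - Q 0) ∧
      IsUnit ((Q 0 - Q t₁) + (S 0)ᵀ * (P t₂ - P 0)⁻¹ * S 0) ∧
      IsUnit ((P 0 - P t₂) + S 0 * (Q t₁ - Q 0)⁻¹ * (S 0)ᵀ) ∧
      P (t₁ + t₂) = P t₁ +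
        S t₁ * ((Q 0 - Q t₁) + (S 0)ᵀ * (P t₂ - P 0)⁻¹ * S 0)⁻¹ * (S t₁)ᵀ ∧
      S (t₁ + t₂) =
        S t₁ * ((Q 0 - Q t₁) + (S 0)ᵀ * (P t₂ - P 0)⁻¹ * S 0)⁻¹ * (S 0)ᵀ *
          (P t₂ - P 0)⁻¹ * S t₂ ∧
      Q (t₁ + t₂) = Q t₂ +
        (S t₂)ᵀ * ((P 0 - P t₂) + S 0 * (Q t₁ - Q 0)⁻¹ * (S 0)ᵀ)⁻¹ * S t₂ := by
    intro t₁ t₂ h₁ h₂ hτ hu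
    have hf := flow (by linarith)
    refine ⟨hu.isUnit, ?_⟩
    -- On `[t₁, 0]` the second flow is the first shifted by `t₂`: it starts at time index `t₁ + t₂`
    -- and ends at `t₂`.
    simpa only [zero_add] using (hf.mono (a' := t₁) (b' := 0) (by linarith) le_rfl).propagation
      (hf.shift (a' := t₁) (b' := 0) (c := t₂) hτ (by linarith)) h₁
      (hctrl t₁ 0 (by linarith) h₁ le_rfl) (by simpa only [zero_add] using hu)
  refine ⟨?_, ?_, ?_⟩
  · intro t₁ t₂ h₁ h₂ hτ hconv
    have hu := isPositive_of_strictConvexOn hconv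
    have hf := flow (by linarith)
    refine ⟨fun x z => ⟨?_, ?_, ?_⟩, fun z z' => ?_, two_time t₁ t₂ h₁ h₂ hτ hu⟩
    · simpa only [zero_add] using
        (hf.shift (a' := t₁) (b' := 0) (c := t₂) hτ (by linarith)).valueOp_eq h₁.le z x
    · simpa only [zero_add, add_comm t₂ t₁] using
        (hf.shift (a' := t₂) (b' := 0) (c := t₁) (by linarith) (by linarith)).valueOp_eq h₂.le z x
    · exact (hf.mono (a' := t₁ + t₂) (b' := t₂) hτ h₂.le).valueOp_eq (by linarith) z x
    · simpa only [zero_add] using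
        (hf.mono (a' := t₁) (b' := 0) (by linarith) le_rfl).semiconvexDual_eq
          (hf.shift (a' := t₁) (b' := 0) (c := t₂) hτ (by linarith)) h₁.le
          (by simpa only [zero_add] using hu) z z'
  · intro Δ hΔ hconv
    -- `Δ = 0` is compatible with strict convexity only in dimension `0`, where all matrices
    -- coincide.
    rcases Nat.eq_zero_or_pos n with rfl | hn
    · refine ⟨fun _ => ⟨?_, ?_, ?_, ?_, ?_, ?_, ?_⟩, fun N _ => ⟨fun z => ⟨convex_univ, ?_⟩, ?_⟩⟩
      iterate 4 exact isUnit_of_subsingleton _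
      iterate 3 exact Subsingleton.elim _ _
      · exact fun x _ y _ hxy => absurd (Subsingleton.elim x y) hxy
      · exact Subsingleton.elim _ _
    have hu := isPositive_of_strictConvexOn hconv
    have hΔ' : 0 < Δ := by
      refine lt_of_le_of_ne hΔ fun h => ?_
      subst h
      have := hu (fun _ => 1) fun h => one_ne_zero (congrFun h ⟨0, hn⟩)
      simp at this
    have double : ∀ T : ℝ, 0 < T → τ ≤ -(2 * T) → IsPositive (P (-T) - P 0) →
        IsPositive (P (-(2 * T)) - P 0) ∧
        (P (-(2 * T)), S (-(2 * T)), Q (-(2 * T))) =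
          doublingStep (P 0) (S 0) (Q 0) (P (-T), S (-T), Q (-T)) := by
      intro T hT hτ hu
      have e : -(2 * T) = -T + -T := by ring
      rw [e] at hτ ⊢
      have hf := flow (by linarith)
      -- Positivity at `-T` propagates to `P(-2T) - P(-T)`; adding `P(-T) - P 0` gives positivity at
      -- `-2T`, so doubling can be iterated.
      have hpos := (hf.mono (a' := -T) (b' := 0) (by linarith) le_rfl).isPositive_sub
        (hf.shift (a' := -T) (b' := 0) (c := -T) hτ (by linarith)).derivP
        (by simpa only [zero_add] using hf.symmP (-T) ⟨by linarith, by linarith⟩)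
        (by simpa only [zero_add] using hu) (-T) ⟨le_rfl, by linarith⟩
      obtain ⟨-, -, -, -, e1, e2, e3⟩ := two_time (-T) (-T) (by linarith) (by linarith) hτ hu
      refine ⟨?_, ?_⟩
      · simpa only [sub_add_sub_cancel] using hpos.add hu
      · simp only [doublingStep]
        rw [← e1, ← e2, ← e3]
    refine ⟨fun hτ => ?_, fun N hN => ?_⟩
    · rw [show -(2 * Δ) = -Δ + -Δ by ring] at hτ ⊢
      exact two_time (-Δ) (-Δ) (by linarith) (by linarith) hτ hu
    · suffices IsPositive (P (-(2 ^ N * Δ)) - P 0) ∧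
          (P (-(2 ^ N * Δ)), S (-(2 ^ N * Δ)), Q (-(2 ^ N * Δ))) =
            (doublingStep (P 0) (S 0) (Q 0))^[N] (P (-Δ), S (-Δ), Q (-Δ)) from
        ⟨this.1.strictConvexOn, this.2⟩
      induction N with
      | zero => simpa using hu
      | succ N ih =>
        have hpos : 0 < 2 ^ N * Δ := by positivity
        have e : 2 ^ (N + 1) * Δ = 2 * (2 ^ N * Δ) := by ring
        rw [e] at hN ⊢
        obtain ⟨i1, i2⟩ := ih (by linarith)
        rw [Function.iterate_succ_apply', ← i2]
        exact double _ hpos hN i1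
  · intro t p hτ ht _ hp hu
    have h := (flow (hτ.trans ht)).mono hτ le_rfl
    have hp' : IsRiccatiOn A C (σ * σᵀ) t 0 p := fun r hr =>
      hasDerivWithinAt_matrix_iff.2 (hp r hr)
    -- The bracket in the claim is minus `diffMat`, which accounts for the sign in front.
    have e : Q t - Q 0 - (S 0)ᵀ * (p 0 - P 0)⁻¹ * S 0 = -diffMat P S Q p 0 t := by
      rw [diffMat]; abel
    have hM := h.isUnit_diffMat hp' hu t ⟨le_rfl, ht⟩
    rw [e]
    refine ⟨hM.neg, ?_⟩
    rw [Matrix.inv_eq_right_inv (B := -(diffMat P S Q p 0 t)⁻¹) (by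
      rw [neg_mul_neg, Matrix.mul_nonsing_inv _ ((Matrix.isUnit_iff_isUnit_det _).1 hM)]),
      Matrix.mul_neg, Matrix.neg_mul, sub_neg_eq_add]
    exact h.riccati_eq hp' hu t ⟨le_rfl, ht⟩
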